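/- Let $q,d\in\mathbb N$, $\alpha>0$ and $K_1,\dots,K_d>0$. Let $V=(V_1,\dots,V_d)^\top$ be a random vector with values in $\mathbb R_+^d$ and Pareto tails: for every $j$, $$P(V_j>t)\sim K_j t^{-\alpha},\qquad t\to\infty .$$ Let $\|\cdot\|$ be a norm on $\mathbb R^d$ with $\|e_j\|=1$ for all unit vectors $e_j$, and suppose that $V$ is multivariate regularly varying with intensity measure $\mu$: $\mu\ne0$ is a Radon measure on $[0,\infty]^d\setminus\{0\}$ with $\mu([0,\infty]^d\setminus\mathbb R_+^d)=0$, and $$\frac{P(V\in t\,\cdot)}{P(\|V\|>t)}\to\mu(\cdot)\quad\text{vaguely on }[0,\infty]^d\setminus\{0\}\text{ as }t\to\infty .$$ Let $i\sim j$ $(1\le i\le q,\ 1\le j\le d)$ be the edges of a random bipartite graph, and let $W$ be a random $q\times d$ matrix with nonnegative entries such that $W_{ij}>0$ whenever $i\sim j$, and $\mathbb E\|W\|^{\alpha+\delta}<\infty$ for some $\delta>0$ and some matrix norm. Suppose that $V$ is independent of the pair consisting of $W$ and the random graph. Put $A_{ij}=W_{ij}\mathbf 1(i\sim j)$ and $F=AV$.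 Let $g,h:\mathbb R_+^q\to\mathbb R_+$ be continuous and 1-homogeneous, that is, $g(ax)=a\,g(x)$ and $h(ax)=a\,h(x)$ for $a>0$, and let $u\in(0,\infty)$. Write $K^{1/\alpha}=\mathrm{diag}(K_1^{1/\alpha},\dots,K_d^{1/\alpha})$, $1=(1,\dots,1)^\top\in\mathbb R^d$, and $$C^h_{\rm ind}=\sum_{j=1}^d K_j\,\mathbb E\,h^\alpha(Ae_j),\qquad C^h_{\rm dep}=\mathbb E\,h^\alpha(AK^{1/\alpha}1).$$ (a) If $V_1,\dots,V_d$ are asymptotically independent, meaning that $\mu$ is concentrated on the coordinate axes, and if $C^h_{\rm ind}\neq0$, then $C^h_{\rm ind}<\infty$ and $$\lim_{t\to\infty}P\big(g(F)>t\mid h(F)>ut\big)=(C^h_{\rm ind})^{-1}\sum_{j=1}^d\mathbb E\min\big\{h^\alpha(AK^{1/\alpha}e_j),\,u^\alpha g^\alpha(AK^{1/\alpha}e_j)\big\}.$$ (b) If $V_1,\dots,V_d$ are asymptotically fully dependent, meaning that $\mu$ is concentrated on the line $\{sK^{1/\alpha}1:s>0\}$, and if $C^h_{\rm dep}\neq0$,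 then $C^h_{\rm dep}<\infty$ and $$\lim_{t\to\infty}P\big(g(F)>t\mid h(F)>ut\big)=(C^h_{\rm dep})^{-1}\,\mathbb E\min\big\{h^\alpha(AK^{1/\alpha}1),\,u^\alpha g^\alpha(AK^{1/\alpha}1)\big\}.$$ -/

import Mathlib

open MeasureTheory ProbabilityTheory Filter Topology Matrix
open scoped NNReal ENNReal

namespace BipartiteRisk

/-- The punctured closed orthant `[0,∞]^d \ {0}`. With the subspace topology its compact subsets are
the closed subsets of `[0,∞]^d` that are bounded away from the origin (one point
uncompactification); its measurable sets are the Borel sets. -/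
abbrev PuncturedOrthant (d : ℕ) : Type := {x : Fin d → ℝ≥0∞ // x ≠ 0}

/-- The measure `B ↦ P(V ∈ t B)` on the Borel sets of `[0,∞]^d \ {0}`. -/
noncomputable def scaledLaw {Ω : Type*} [MeasurableSpace Ω] (P : Measure Ω) {d : ℕ}
    (V : Ω → Fin d → ℝ≥0) (t : ℝ≥0) : Measure (PuncturedOrthant d) :=
  (P.map (fun ω j => ((V ω j / t : ℝ≥0) : ℝ≥0∞))).comap Subtype.val

/-- A seminorm on a real vector space that is a norm. -/
def IsNorm {E : Type*} [AddCommGroup E] [Module ℝ E] (N : Seminorm ℝ E) : Prop :=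
  ∀ x, N x = 0 → x = 0

/-- `V` is multivariate regularly varying with intensity measure `μ`, with respect to the reference
norm `N`: `μ` is a nonzero Radon measure on `[0,∞]^d \ {0}` without mass on the points that have an
infinite coordinate, and `P(V ∈ t ·) / P(N(V) > t)` converges vaguely to `μ` as `t → ∞`. -/
structure IsIntensityMeasure {Ω : Type*} [MeasurableSpace Ω] (P : Measure Ω) {d : ℕ}
    (N : Seminorm ℝ (Fin d → ℝ)) (V : Ω → Fin d → ℝ≥0)
    (μ : Measure (PuncturedOrthant d)) : Prop where
  radon : IsFiniteMeasureOnCompacts μ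
  ne_zero : μ ≠ 0
  infinite_null : μ {x | ∃ j, x.1 j = ⊤} = 0
  vague : ∀ f : PuncturedOrthant d → ℝ, Continuous f → HasCompactSupport f →
    Tendsto (fun t : ℝ≥0 =>
        (∫ x, f x ∂(scaledLaw P V t)) / P.real {ω | (t : ℝ) < N (fun j => (V ω j : ℝ))})
      atTop (𝓝 (∫ x, f x ∂μ))

/-- Asymptotic independence: the intensity measure lives on the coordinate axes. -/
def AsymptoticallyIndependent {d : ℕ} (μ : Measure (PuncturedOrthant d)) : Prop :=
  μ {x | ∃ i j, i ≠ j ∧ x.1 i ≠ 0 ∧ x.1 j ≠ 0} = 0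

/-- The vector `K^{1/α} x`, where `K^{1/α} = diag(K_1^{1/α}, …, K_d^{1/α})`. -/
noncomputable def scaleK {d : ℕ} (K : Fin d → ℝ≥0) (α : ℝ) (x : Fin d → ℝ≥0) : Fin d → ℝ≥0 :=
  Matrix.diagonal (fun j => K j ^ (1 / α)) *ᵥ x

/-- Asymptotic full dependence: the intensity measure lives on the line `{s K^{1/α} 1 : s > 0}`. -/
def AsymptoticallyFullyDependent {d : ℕ} (K : Fin d → ℝ≥0) (α : ℝ)
    (μ : Measure (PuncturedOrthant d)) : Prop :=
  μ {x | ¬ ∃ s : ℝ≥0, 0 < s ∧ ∀ j, x.1 j = ((s * scaleK K α 1 j : ℝ≥0) : ℝ≥0∞)} = 0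

open Classical in
/-- The weighted adjacency matrix `A_{ij} = W_{ij} 1(i ∼ j)`; `R ω i j` says that agent `i` and
object `j` are linked. -/
noncomputable def weightedAdjacency {Ω : Type*} {q d : ℕ} (W : Ω → Matrix (Fin q) (Fin d) ℝ≥0)
    (R : Ω → Fin q → Fin d → Prop) (ω : Ω) : Matrix (Fin q) (Fin d) ℝ≥0 :=
  Matrix.of fun i j => if R ω i j then W ω i j else 0

/-- The exposure vector `F = A V`. -/
noncomputable def exposure {Ω : Type*} {q d : ℕ} (A : Ω → Matrix (Fin q) (Fin d) ℝ≥0)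
    (V : Ω → Fin d → ℝ≥0) (ω : Ω) : Fin q → ℝ≥0 :=
  A ω *ᵥ V ω

/-- `h (a x) = a h(x)` for all `a > 0`. -/
def IsOneHomogeneous {q : ℕ} (h : (Fin q → ℝ≥0) → ℝ≥0) : Prop :=
  ∀ (a : ℝ≥0) (x : Fin q → ℝ≥0), 0 < a → h (a • x) = a * h x

/-- `C^h_ind = ∑_j K_j E h^α(A e_j)`. -/
noncomputable def constInd {Ω : Type*} [MeasurableSpace Ω] (P : Measure Ω) {q d : ℕ}
    (A : Ω → Matrix (Fin q) (Fin d) ℝ≥0) (K : Fin d → ℝ≥0) (α : ℝ)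
    (h : (Fin q → ℝ≥0) → ℝ≥0) : ℝ≥0∞ :=
  ∑ j, (K j : ℝ≥0∞) * ∫⁻ ω, ((h (A ω *ᵥ Pi.single j 1) ^ α : ℝ≥0) : ℝ≥0∞) ∂P

/-- `C^h_dep = E h^α(A K^{1/α} 1)`. -/
noncomputable def constDep {Ω : Type*} [MeasurableSpace Ω] (P : Measure Ω) {q d : ℕ}
    (A : Ω → Matrix (Fin q) (Fin d) ℝ≥0) (K : Fin d → ℝ≥0) (α : ℝ)
    (h : (Fin q → ℝ≥0) → ℝ≥0) : ℝ≥0∞ :=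
  ∫⁻ ω, ((h (A ω *ᵥ scaleK K α 1) ^ α : ℝ≥0) : ℝ≥0∞) ∂P

/-- `E min{h^α(A K^{1/α} x), u^α g^α(A K^{1/α} x)}`. -/
noncomputable def expectMin {Ω : Type*} [MeasurableSpace Ω] (P : Measure Ω) {q d : ℕ}
    (A : Ω → Matrix (Fin q) (Fin d) ℝ≥0) (K : Fin d → ℝ≥0) (α : ℝ) (u : ℝ≥0)
    (g h : (Fin q → ℝ≥0) → ℝ≥0) (x : Fin d → ℝ≥0) : ℝ≥0∞ :=
  ∫⁻ ω, ((min (h (A ω *ᵥ scaleK K α x) ^ α)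
    (u ^ α * g (A ω *ᵥ scaleK K α x) ^ α) : ℝ≥0) : ℝ≥0∞) ∂P

end BipartiteRisk

/-! In both cases `μ` sits on finitely many rays, through the points `x_j = K^{1/α} e_j` or through
the single point `K^{1/α} 1`. Vague convergence serves only to show that leaving these rays is
negligible: if a compactly supported test function vanishes `μ`-almost everywhere, the event it
detects has probability `o(t^{-α})` (`IsIntensityMeasure.tendsto_of_ae_zero`). The mass along a ray
is read off from the Pareto marginals, so `μ` itself never has to be identified. A continuous
1-homogeneous `φ` is almost linear near a ray, whence `t^α P(φ(V) > t) → ∑ φ(x_j)^α`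
(`hasTail_of_sandwich` and the two `hasRayTail` theorems).

For a fixed matrix `a`, the map `v ↦ m(a v)` is again continuous and homogeneous. Independence
permits conditioning on `A`, and a bound on `t^α P(∑ V_j > t)` uniform in `t` dominates the
conditional tails by a multiple of `(∑ A_ij)^α`, so the limit passes through the expectation
(`HasRayTail.tendsto_mulVec`). Finally `{h(F) > ut, g(F) > t} = {min(h, u g)(F) > ut}`, and `min(h,
u g)` is again continuous and homogeneous: the conditional probability is a quotient of two such
tails at the same level. -/

namespace BipartiteRisk

/-- `X` has a Pareto tail of index `α` with constant `κ`: `t^α P(X > t) → κ`. -/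
def HasTail {Ω : Type*} [MeasurableSpace Ω] (P : Measure Ω) (α : ℝ) (X : Ω → ℝ≥0) (κ : ℝ) : Prop :=
  Tendsto (fun t : ℝ≥0 => (t : ℝ) ^ α * P.real {ω | t < X ω}) atTop (𝓝 κ)

/-! ### Pareto tails: scaling, uniform bounds, sandwich argument -/

section Tails

variable {Ω : Type*} [MeasurableSpace Ω] {P : Measure Ω} {α : ℝ}

theorem hasTail_of_isEquivalent {X : Ω → ℝ≥0} {k : ℝ≥0}
    (h : Asymptotics.IsEquivalent atTop (fun t : ℝ≥0 => P.real {ω | t < X ω})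
      (fun t : ℝ≥0 => (k : ℝ) * (t : ℝ) ^ (-α))) : HasTail P α X k := by
  have h1 := (Asymptotics.IsEquivalent.refl (u := fun t : ℝ≥0 => (t : ℝ) ^ α) (l := atTop)).mul h
  refine h1.symm.tendsto_nhds ?_
  refine tendsto_const_nhds.congr' ?_
  filter_upwards [eventually_gt_atTop 0] with t ht
  have ht' : (0 : ℝ) < t := ht
  have : (t : ℝ) ^ α ≠ 0 := (Real.rpow_pos_of_pos ht' α).ne'
  simp only [Pi.mul_apply, Real.rpow_neg ht'.le]
  field_simp

theorem HasTail.const_mul (hα : 0 < α) {X : Ω → ℝ≥0} {κ : ℝ} (h : HasTail P α X κ) (c : ℝ≥0) :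
    HasTail P α (fun ω => c * X ω) ((c : ℝ) ^ α * κ) := by
  rcases eq_or_ne c 0 with rfl | hc
  · simp [HasTail, Real.zero_rpow hα.ne']
  have hc' : 0 < c := pos_iff_ne_zero.2 hc
  have h1 : Tendsto (fun t : ℝ≥0 => t / c) atTop atTop := tendsto_id.atTop_div_const hc'
  refine ((h.comp h1).const_mul ((c : ℝ) ^ α)).congr fun t => ?_
  have h2 : {ω | t / c < X ω} = {ω | t < c * X ω} := by
    ext ω
    simp [div_lt_iff₀' hc']
  simp only [Function.comp_apply, h2, NNReal.coe_div]
  rw [Real.div_rpow t.coe_nonneg c.coe_nonneg]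
  have : (c : ℝ) ^ α ≠ 0 := (Real.rpow_pos_of_pos hc' α).ne'
  field_simp

variable [IsProbabilityMeasure P]

/-- The limit controls large `t`, and `P ≤ 1` controls the rest. Uniformity over all `t`, small ones
included, is what dominated convergence needs later. -/
theorem HasTail.exists_bound (hα : 0 < α) {X : Ω → ℝ≥0} {κ : ℝ} (h : HasTail P α X κ) :
    ∃ B : ℝ, ∀ t : ℝ≥0, (t : ℝ) ^ α * P.real {ω | t < X ω} ≤ B := by
  obtain ⟨t₀, ht₀⟩ := eventually_atTop.1 (h.eventually (eventually_le_nhds (lt_add_one κ)))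
  refine ⟨max (κ + 1) ((t₀ : ℝ) ^ α), fun t => ?_⟩
  rcases le_total t₀ t with ht | ht
  · exact (ht₀ t ht).trans (le_max_left _ _)
  · refine le_trans ?_ (le_max_right _ _)
    calc (t : ℝ) ^ α * P.real {ω | t < X ω} ≤ (t₀ : ℝ) ^ α * 1 := by
          gcongr
          · exact measureReal_le_one
      _ = _ := mul_one _

theorem exists_lt_card_mul {d : ℕ} {t : ℝ≥0} {v : Fin d → ℝ≥0} (h : t < ∑ j, v j) :
    ∃ j, t < (d : ℝ≥0) * v j := by
  by_contra! hc
  rcases Nat.eq_zero_or_pos d with rfl | hd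
  · simp at h
  have h1 : ∑ j, (d : ℝ≥0) * v j ≤ ∑ _j : Fin d, t := Finset.sum_le_sum fun j _ => hc j
  rw [← Finset.mul_sum] at h1
  simp only [Finset.sum_const, Finset.card_univ, Fintype.card_fin, nsmul_eq_mul] at h1
  exact absurd (le_of_mul_le_mul_left h1 (by exact_mod_cast hd)) (not_le.2 h)

theorem exists_bound_sum (hα : 0 < α) {d : ℕ} {V : Ω → Fin d → ℝ≥0} {κ : Fin d → ℝ}
    (h : ∀ j, HasTail P α (fun ω => V ω j) (κ j)) :
    ∃ B : ℝ≥0, ∀ t : ℝ≥0, (t : ℝ) ^ α * P.real {ω | t < ∑ j, V ω j} ≤ B := by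
  choose B hB using fun j => ((h j).const_mul hα (d : ℝ≥0)).exists_bound hα
  refine ⟨(∑ j, B j).toNNReal, fun t => ?_⟩
  refine le_trans ?_ (Real.le_coe_toNNReal _)
  calc (t : ℝ) ^ α * P.real {ω | t < ∑ j, V ω j}
      ≤ (t : ℝ) ^ α * P.real (⋃ j, {ω | t < (d : ℝ≥0) * V ω j}) := by
        gcongr
        · exact measure_ne_top _ _
        · intro ω hω
          simpa using exists_lt_card_mul hω
    _ ≤ (t : ℝ) ^ α * ∑ j, P.real {ω | t < (d : ℝ≥0) * V ω j} := by
        gcongr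
        exact measureReal_iUnion_fintype_le _
    _ ≤ ∑ j, B j := by
        rw [Finset.mul_sum]
        exact Finset.sum_le_sum fun j _ => hB j t

/-- Up to asymptotically negligible events, `X > t` is the disjoint union of the events
`c_j Y_j > t`. -/
theorem hasTail_of_sandwich (hα : 0 < α) {J : Type*} [Fintype J] {X : Ω → ℝ≥0} {Y : J → Ω → ℝ≥0}
    (hYm : ∀ j, Measurable (Y j)) {c : J → ℝ≥0} (hY : ∀ j, HasTail P α (Y j) 1)
    (H : ∀ η : ℝ≥0, 0 < η → ∃ B : ℝ≥0 → Set Ω, (∀ t, MeasurableSet (B t)) ∧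
      Tendsto (fun t : ℝ≥0 => (t : ℝ) ^ α * P.real (B t)) atTop (𝓝 0) ∧
      ∀ t ω, ω ∉ B t → (t < X ω → ∃ j, t < (c j + η) * Y j ω) ∧
        ∀ j, t < (c j - η) * Y j ω → t < X ω ∧ ∀ i, t < (c i - η) * Y i ω → i = j) :
    HasTail P α X (∑ j, (c j : ℝ) ^ α) := by
  -- For each `b` on one side of the limit, `η` is taken so small that `∑ (c_j ∓ η)^α` stays on that
  -- side; only then is `t` sent to infinity.
  refine tendsto_order.2 ⟨fun b hb => ?_, fun b hb => ?_⟩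
  · have hcont : Tendsto (fun η : ℝ≥0 => ∑ j, ((c j - η : ℝ≥0) : ℝ) ^ α) (𝓝[>] 0)
        (𝓝 (∑ j, (c j : ℝ) ^ α)) := by
      have : Continuous (fun η : ℝ≥0 => ∑ j, ((c j - η : ℝ≥0) : ℝ) ^ α) := by
        refine continuous_finsetSum _ fun j _ => Continuous.rpow_const ?_ fun _ => Or.inr hα.le
        exact NNReal.continuous_coe.comp (continuous_const.sub continuous_id)
      simpa using (this.tendsto 0).mono_left nhdsWithin_le_nhds
    obtain ⟨η, hηb, hη⟩ := ((hcont.eventually (lt_mem_nhds hb)).and self_mem_nhdsWithin).exists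
    obtain ⟨B, hBm, hB, hBX⟩ := H η hη
    have hlim : Tendsto (fun t : ℝ≥0 => ∑ j, (t : ℝ) ^ α * P.real {ω | t < (c j - η) * Y j ω}
        - Fintype.card J * ((t : ℝ) ^ α * P.real (B t))) atTop
        (𝓝 (∑ j, ((c j - η : ℝ≥0) : ℝ) ^ α)) := by
      have h1 := (tendsto_finsetSum Finset.univ
        fun j _ => (hY j).const_mul hα (c j - η)).sub (hB.const_mul (Fintype.card J : ℝ))
      simpa using h1
    filter_upwards [hlim.eventually (lt_mem_nhds hηb)] with t ht
    refine ht.trans_le ?_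
    have hEm : ∀ j, MeasurableSet ({ω | t < (c j - η) * Y j ω} \ B t) := fun j =>
      (measurableSet_lt measurable_const ((hYm j).const_mul _)).diff (hBm t)
    -- Off `B t` the lower events are pairwise disjoint, so their probabilities add up.
    have h1 : ∑ j, P.real ({ω | t < (c j - η) * Y j ω} \ B t) ≤ P.real {ω | t < X ω} := by
      rw [← measureReal_iUnion_fintype]
      · refine measureReal_mono ?_
        refine Set.iUnion_subset fun j ω hω => ((hBX t ω hω.2).2 j hω.1).1
      · intro i j hij
        refine Set.disjoint_left.2 fun ω hi hj => hij ?_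
        exact ((hBX t ω hi.2).2 j hj.1).2 i hi.1
      · exact hEm
    have h2 : ∀ j, P.real {ω | t < (c j - η) * Y j ω} ≤
        P.real ({ω | t < (c j - η) * Y j ω} \ B t) + P.real (B t) := fun j => by
      refine le_trans (measureReal_mono ?_) (measureReal_union_le _ _)
      intro ω hω
      by_cases hb : ω ∈ B t
      · exact Or.inr hb
      · exact Or.inl ⟨hω, hb⟩
    have h3 := Finset.sum_le_sum fun j (_ : j ∈ Finset.univ) => h2 j
    rw [Finset.sum_add_distrib, Finset.sum_const, Finset.card_univ, nsmul_eq_mul] at h3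
    have h4 : ∑ j, P.real {ω | t < (c j - η) * Y j ω} - Fintype.card J * P.real (B t)
      ≤ P.real {ω | t < X ω} := by linarith
    calc _ = (t : ℝ) ^ α *
          (∑ j, P.real {ω | t < (c j - η) * Y j ω} - Fintype.card J * P.real (B t)) := by
          rw [← Finset.mul_sum]; ring
      _ ≤ _ := by gcongr
  · have hcont : Tendsto (fun η : ℝ≥0 => ∑ j, ((c j + η : ℝ≥0) : ℝ) ^ α) (𝓝[>] 0)
        (𝓝 (∑ j, (c j : ℝ) ^ α)) := by
      have : Continuous (fun η : ℝ≥0 => ∑ j, ((c j + η : ℝ≥0) : ℝ) ^ α) := by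
        refine continuous_finsetSum _ fun j _ => Continuous.rpow_const ?_ fun _ => Or.inr hα.le
        fun_prop
      simpa using (this.tendsto 0).mono_left nhdsWithin_le_nhds
    obtain ⟨η, hηb, hη⟩ := ((hcont.eventually (gt_mem_nhds hb)).and self_mem_nhdsWithin).exists
    obtain ⟨B, hBm, hB, hBX⟩ := H η hη
    have hlim : Tendsto (fun t : ℝ≥0 => ∑ j, (t : ℝ) ^ α * P.real {ω | t < (c j + η) * Y j ω}
        + (t : ℝ) ^ α * P.real (B t)) atTop
        (𝓝 (∑ j, ((c j + η : ℝ≥0) : ℝ) ^ α)) := by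
      have h1 := (tendsto_finsetSum Finset.univ
        fun j _ => (hY j).const_mul hα (c j + η)).add hB
      simpa using h1
    filter_upwards [hlim.eventually (gt_mem_nhds hηb)] with t ht
    refine lt_of_le_of_lt ?_ ht
    have h1 : P.real {ω | t < X ω} ≤
        ∑ j, P.real {ω | t < (c j + η) * Y j ω} + P.real (B t) := by
      refine le_trans (measureReal_mono (s₂ := (⋃ j, {ω | t < (c j + η) * Y j ω}) ∪ B t) ?_) ?_
      · intro ω hω
        by_cases hb : ω ∈ B t
        · exact Or.inr hb
        · exact Or.inl (by simpa using (hBX t ω hb).1 hω)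
      · refine (measureReal_union_le _ _).trans ?_
        gcongr
        exact measureReal_iUnion_fintype_le _
    calc _ ≤ (t : ℝ) ^ α * (∑ j, P.real {ω | t < (c j + η) * Y j ω} + P.real (B t)) := by gcongr
      _ = _ := by rw [← Finset.mul_sum]; ring

end Tails

/-! ### Continuous 1-homogeneous functions -/

section Homogeneous

variable {d : ℕ} {φ : (Fin d → ℝ≥0) → ℝ≥0}

theorem IsOneHomogeneous.map_zero (hφ : IsOneHomogeneous φ) : φ 0 = 0 := by
  have h := hφ 2 0 (by norm_num)
  rw [smul_zero] at h
  have h' : (φ 0 : ℝ) = 2 * φ 0 := by exact_mod_cast h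
  have : (φ 0 : ℝ) = 0 := by linarith
  exact_mod_cast this

theorem IsOneHomogeneous.map_smul (hφ : IsOneHomogeneous φ) (a : ℝ≥0) (x : Fin d → ℝ≥0) :
    φ (a • x) = a * φ x := by
  rcases eq_or_ne a 0 with rfl | ha
  · simp [hφ.map_zero]
  · exact hφ a x (pos_iff_ne_zero.2 ha)

/-- Dividing `x` by its coordinate sum puts it in the unit cube, where `φ` is bounded by
compactness; homogeneity undoes the scaling. -/
theorem IsOneHomogeneous.exists_le_mul_sum (hφ : IsOneHomogeneous φ) (hc : Continuous φ) :
    ∃ L : ℝ≥0, 0 < L ∧ ∀ x, φ x ≤ L * ∑ j, x j := by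
  have hK : IsCompact (Set.univ.pi fun _ : Fin d => Set.Icc (0 : ℝ≥0) 1) :=
    isCompact_univ_pi fun _ => isCompact_Icc
  obtain ⟨L, hL⟩ := (hK.image hc).bddAbove
  refine ⟨L + 1, by positivity, fun x => ?_⟩
  rcases eq_or_ne (∑ j, x j) 0 with hs | hs
  · have : x = 0 := by
      ext j
      simpa using (Finset.sum_eq_zero_iff.1 hs) j (Finset.mem_univ j)
    simp [this, hφ.map_zero]
  · have h1 : φ ((∑ j, x j)⁻¹ • x) ≤ L := by
      refine hL (Set.mem_image_of_mem _ fun j _ => ⟨zero_le, ?_⟩)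
      simp only [Pi.smul_apply, smul_eq_mul]
      rw [inv_mul_le_iff₀ (pos_iff_ne_zero.2 hs), mul_one]
      exact Finset.single_le_sum (f := x) (fun _ _ => zero_le) (Finset.mem_univ j)
    have h2 : φ x = (∑ j, x j) * φ ((∑ j, x j)⁻¹ • x) := by
      rw [← hφ.map_smul, smul_smul, mul_inv_cancel₀ hs, one_smul]
    rw [h2, mul_comm]
    gcongr
    exact h1.trans (by simp)

/-- A continuous homogeneous function varies little near a ray. -/
theorem IsOneHomogeneous.exists_near_ray (hφ : IsOneHomogeneous φ) (hc : Continuous φ)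
    (x : Fin d → ℝ≥0) {η : ℝ≥0} (hη : 0 < η) :
    ∃ ρ : ℝ, 0 < ρ ∧ ∀ (s : ℝ≥0) (v : Fin d → ℝ≥0),
      (∀ i, |(v i : ℝ) - s * x i| ≤ ρ * s) → φ v ≤ (φ x + η) * s ∧ (φ x - η) * s ≤ φ v := by
  obtain ⟨ρ, hρ, h⟩ := Metric.continuousAt_iff.1 (hc.continuousAt (x := x)) η hη
  -- Halving turns the non-strict hypothesis into the strict inequality that continuity at `x` asks
  -- for.
  refine ⟨ρ / 2, by positivity, fun s v hv => ?_⟩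
  rcases eq_or_ne s 0 with rfl | hs
  · have : v = 0 := by
      ext i
      simpa using abs_nonpos_iff.1 (by simpa using hv i : |(v i : ℝ)| ≤ 0)
    simp [this, hφ.map_zero]
  have hs' : (0 : ℝ) < s := NNReal.coe_pos.2 (pos_iff_ne_zero.2 hs)
  have h1 : dist (s⁻¹ • v) x < ρ := by
    refine lt_of_le_of_lt ((dist_pi_le_iff (by positivity)).2 fun i => ?_) (half_lt_self hρ)
    rw [NNReal.dist_eq]
    have e : ((s⁻¹ • v) i : ℝ) - x i = (s : ℝ)⁻¹ * (v i - s * x i) := by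
      simp only [Pi.smul_apply, smul_eq_mul, NNReal.coe_mul, NNReal.coe_inv]
      field_simp
    rw [e, abs_mul, abs_of_pos (by positivity), inv_mul_le_iff₀ hs', mul_comm (s : ℝ) (ρ / 2)]
    exact hv i
  have h2 := h h1
  rw [NNReal.dist_eq, abs_lt] at h2
  have h3 : φ v = φ (s⁻¹ • v) * s := by
    rw [mul_comm, ← hφ.map_smul, smul_smul, mul_inv_cancel₀ hs, one_smul]
  rw [h3]
  constructor
  · gcongr
    rw [← NNReal.coe_le_coe]
    push_cast
    linarith
  · gcongr
    rw [tsub_le_iff_right, ← NNReal.coe_le_coe]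
    push_cast
    linarith

end Homogeneous

end BipartiteRisk

namespace BipartiteRisk

/-! ### Comparison of norms in finite dimension -/

section NormComparison

theorem IsNorm.exists_norm_le {E : Type*} [NormedAddCommGroup E] [NormedSpace ℝ E]
    -- `N` attains a positive minimum on the compact unit sphere. This serves the reference norm on
    -- the losses and the matrix norm on the weights alike.
    [FiniteDimensional ℝ E] {N : Seminorm ℝ E} (hN : IsNorm N) :
    ∃ C : ℝ≥0, 0 < C ∧ ∀ x, ‖x‖ ≤ C * N x := by
  have : ProperSpace E := FiniteDimensional.proper_real E
  have hc : Continuous N := by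
    have := N.convexOn.continuousOn isOpen_univ
    rwa [continuousOn_univ] at this
  rcases subsingleton_or_nontrivial E with hE | hE
  · exact ⟨1, one_pos, fun x => by simp [Subsingleton.elim x 0]⟩
  obtain ⟨x₀, hx₀, hmin⟩ := (isCompact_sphere (0 : E) 1).exists_isMinOn
    (NormedSpace.sphere_nonempty.2 zero_le_one) hc.continuousOn
  have hx₀' : ‖x₀‖ = 1 := by simpa using hx₀
  have hpos : 0 < N x₀ := by
    refine lt_of_le_of_ne (apply_nonneg N x₀) fun h => ?_
    have := hN x₀ h.symm
    simp [this] at hx₀'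
  refine ⟨⟨(N x₀)⁻¹, by positivity⟩, NNReal.coe_pos.1 (inv_pos.2 hpos), fun x => ?_⟩
  rcases eq_or_ne x 0 with rfl | hx
  · simp
  have hx' : 0 < ‖x‖ := norm_pos_iff.2 hx
  have h1 : N x₀ ≤ N (‖x‖⁻¹ • x) := hmin (by simp [norm_smul, hx'.ne'])
  rw [map_smul_eq_mul, norm_inv, norm_norm] at h1
  change ‖x‖ ≤ (N x₀)⁻¹ * N x
  rw [le_inv_mul_iff₀ hpos, mul_comm]
  calc ‖x‖ * N x₀ ≤ ‖x‖ * (‖x‖⁻¹ * N x) := by gcongr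
    _ = N x := by field_simp

theorem seminorm_le_sum {d : ℕ} {N : Seminorm ℝ (Fin d → ℝ)}
    (hN_unit : ∀ j, N (Pi.single j 1) = 1) (v : Fin d → ℝ≥0) :
    N (fun j => (v j : ℝ)) ≤ ∑ j, (v j : ℝ) := by
  have h : (fun j => (v j : ℝ)) = ∑ j, (v j : ℝ) • (Pi.single j 1 : Fin d → ℝ) := by
    ext i
    simp [Finset.sum_apply, Pi.single_apply]
  refine (congrArg N h).trans_le ?_
  refine (Finset.le_sum_of_subadditive N (map_zero N).le (map_add_le_add N) _ _).trans (Finset.sum_le_sum fun j _ => ?_)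
  rw [map_smul_eq_mul, hN_unit, mul_one, Real.norm_of_nonneg (NNReal.coe_nonneg _)]

end NormComparison

/-! ### Consequences of vague convergence -/

section VagueConvergence

variable {Ω : Type*} [MeasurableSpace Ω] {P : Measure Ω} [IsProbabilityMeasure P] {α : ℝ} {d : ℕ}

-- For `d = 0` the punctured orthant is empty and carries no nonzero measure.
omit [IsProbabilityMeasure P] in
theorem IsIntensityMeasure.nonempty_fin {V : Ω → Fin d → ℝ≥0} {N : Seminorm ℝ (Fin d → ℝ)}
    {μ : Measure (PuncturedOrthant d)} (hμ : IsIntensityMeasure P N V μ) : Nonempty (Fin d) := by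
  by_contra h
  rw [not_nonempty_iff] at h
  have : IsEmpty (PuncturedOrthant d) := ⟨fun x => x.2 (Subsingleton.elim _ _)⟩
  exact hμ.ne_zero (Measure.eq_zero_of_isEmpty μ)

/-- The image in `[0,∞]^d` is closed in a compact space. Hence test functions need only vanish near
the origin, not near infinity. -/
theorem isCompact_away {η : ℝ≥0∞} (hη : 0 < η) :
    IsCompact {x : PuncturedOrthant d | ∃ j, η ≤ x.1 j} := by
  rw [Subtype.isCompact_iff]
  have h : (Subtype.val '' {x : PuncturedOrthant d | ∃ j, η ≤ x.1 j}) =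
      ⋃ j, {x : Fin d → ℝ≥0∞ | η ≤ x j} := by
    ext x
    simp only [Set.mem_image, Set.mem_ofPred_eq, Subtype.exists, Set.mem_iUnion]
    constructor
    · rintro ⟨y, -, hj, rfl⟩
      exact hj
    · rintro ⟨j, hj⟩
      refine ⟨x, fun h0 => ?_, ⟨j, hj⟩, rfl⟩
      rw [h0] at hj
      exact absurd hj (not_le.2 hη)
  rw [h]
  exact (isClosed_iUnion_of_finite fun j =>
    isClosed_le continuous_const (continuous_apply j)).isCompact

-- Removing the origin loses nothing because `G` vanishes there.
omit [IsProbabilityMeasure P] in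
theorem integral_scaledLaw {V : Ω → Fin d → ℝ≥0} (hV : Measurable V) {G : (Fin d → ℝ≥0∞) → ℝ}
    (hGc : Continuous G) (hG0 : G 0 = 0) (t : ℝ≥0) :
    ∫ x, G x.1 ∂(scaledLaw P V t) = ∫ ω, G (fun j => ((V ω j / t : ℝ≥0) : ℝ≥0∞)) ∂P := by
  have hs : MeasurableSet {x : Fin d → ℝ≥0∞ | x ≠ 0} := (measurableSet_singleton 0).compl
  have hm : Measurable (fun ω j => ((V ω j / t : ℝ≥0) : ℝ≥0∞)) := by
    refine measurable_pi_lambda _ fun j => ?_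
    exact (((measurable_pi_apply j).comp hV).div_const t).coe_nnreal_ennreal
  refine (integral_subtype_comap hs G).trans ?_
  rw [setIntegral_eq_integral_of_forall_compl_eq_zero,
    integral_map hm.aemeasurable hGc.aestronglyMeasurable]
  intro x hx
  have : x = 0 := by simpa using hx
  rw [this, hG0]

/-- A set that is detected by a test function vanishing `μ`-almost everywhere is asymptotically
negligible at the scale `t^{-α}`. -/
theorem IsIntensityMeasure.tendsto_of_ae_zero (hα : 0 < α) {V : Ω → Fin d → ℝ≥0} (hV : Measurable V)
    {K : Fin d → ℝ≥0} (hK : ∀ j, 0 < K j) (hT : ∀ j, HasTail P α (fun ω => V ω j) (K j))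
    {N : Seminorm ℝ (Fin d → ℝ)} (hN : IsNorm N) (hN_unit : ∀ j, N (Pi.single j 1) = 1)
    {μ : Measure (PuncturedOrthant d)} (hμ : IsIntensityMeasure P N V μ)
    {G : (Fin d → ℝ≥0∞) → ℝ} (hGc : Continuous G) (hG : ∀ x, 0 ≤ G x) {η : ℝ≥0∞} (hη : 0 < η)
    (hGη : ∀ x, (∀ j, x j < η) → G x = 0) (hGμ : ∀ᵐ x ∂μ, G x.1 = 0) {c : ℝ} (hc : 0 < c) :
    Tendsto (fun t : ℝ≥0 => (t : ℝ) ^ α *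
      P.real {ω | c ≤ G (fun j => ((V ω j / t : ℝ≥0) : ℝ≥0∞))}) atTop (𝓝 0) := by
  obtain ⟨j₀⟩ := hμ.nonempty_fin
  obtain ⟨C, hC, hCN⟩ := hN.exists_norm_le
  obtain ⟨B, hB⟩ := exists_bound_sum hα hT
  have hG0 : G 0 = 0 := hGη 0 fun j => hη
  set p : ℝ≥0 → ℝ := fun t => P.real {ω | (t : ℝ) < N (fun j => (V ω j : ℝ))} with hp
  -- The normalizing probability must be cancelled below. It is positive because `N(V) ≥ C⁻¹ V_{j₀}`
  -- and one coordinate already has a nontrivial Pareto tail.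
  have hpos : ∀ᶠ t in atTop, 0 < p t := by
    have h1 := (hT j₀).const_mul hα C⁻¹
    have h2 : (0 : ℝ) < ((C⁻¹ : ℝ≥0) : ℝ) ^ α * K j₀ :=
      mul_pos (Real.rpow_pos_of_pos (by positivity) _) (hK j₀)
    filter_upwards [h1.eventually (lt_mem_nhds h2)] with t ht
    have h3 : 0 < P.real {ω | t < C⁻¹ * V ω j₀} :=
      pos_of_mul_pos_right ht (Real.rpow_nonneg t.2 α)
    refine h3.trans_le (measureReal_mono fun ω hω => ?_)
    have h4 : (t : ℝ) < (C : ℝ)⁻¹ * V ω j₀ := by exact_mod_cast hω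
    refine h4.trans_le ?_
    rw [inv_mul_le_iff₀ (NNReal.coe_pos.2 hC)]
    refine le_trans ?_ (hCN _)
    simpa using norm_le_pi_norm (fun j => (V ω j : ℝ)) j₀
  have hpB : ∀ t : ℝ≥0, (t : ℝ) ^ α * p t ≤ B := fun t => by
    refine le_trans ?_ (hB t)
    refine mul_le_mul_of_nonneg_left (measureReal_mono fun ω hω => ?_) (Real.rpow_nonneg t.2 α)
    have := lt_of_lt_of_le hω (seminorm_le_sum hN_unit (V ω))
    change t < ∑ j, V ω j
    exact_mod_cast this
  have hvague := hμ.vague (fun x => G x.1) (hGc.comp continuous_subtype_val)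
    (HasCompactSupport.intro (isCompact_away hη) fun x hx => hGη _ fun j => by
      by_contra hj
      exact hx ⟨j, not_lt.1 hj⟩)
  rw [integral_eq_zero_of_ae hGμ] at hvague
  have hlim := hvague.const_mul (c⁻¹ * B)
  rw [mul_zero] at hlim
  refine tendsto_of_tendsto_of_tendsto_of_le_of_le' tendsto_const_nhds hlim
    (Eventually.of_forall fun t => by positivity) ?_
  filter_upwards [hpos] with t ht
  rw [integral_scaledLaw hV hGc hG0]
  set I := ∫ ω, G (fun j => ((V ω j / t : ℝ≥0) : ℝ≥0∞)) ∂P with hI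
  have hI0 : 0 ≤ I := integral_nonneg fun ω => hG _
  -- Markov's inequality. The quotient `I / p t` tends to zero by vague convergence, while `t^α p t`
  -- stays bounded.
  have hmark : c * P.real {ω | c ≤ G (fun j => ((V ω j / t : ℝ≥0) : ℝ≥0∞))} ≤ I := by
    refine mul_meas_ge_le_integral_of_nonneg (ae_of_all _ fun ω => hG _) ?_ c
    obtain ⟨D, hD⟩ := (isCompact_range hGc).isBounded.exists_norm_le
    refine Integrable.of_bound (C := D) ?_ (ae_of_all _ fun ω => hD _ (Set.mem_range_self _))
    refine (hGc.measurable.comp (measurable_pi_lambda _ fun j => ?_)).aestronglyMeasurable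
    exact (((measurable_pi_apply j).comp hV).div_const t).coe_nnreal_ennreal
  calc (t : ℝ) ^ α * P.real {ω | c ≤ G (fun j => ((V ω j / t : ℝ≥0) : ℝ≥0∞))}
      ≤ (t : ℝ) ^ α * (c⁻¹ * I) := by
        gcongr
        rwa [le_inv_mul_iff₀ hc]
    _ = c⁻¹ * ((t : ℝ) ^ α * p t) * (I / p t) := by field_simp
    _ ≤ c⁻¹ * B * (I / p t) := by
        gcongr
        exact hpB t

/-- The multivariate tail of `V`, evaluated on continuous homogeneous functionals, is carried by
the rays through the points `x_j`. -/
def HasRayTail (P : Measure Ω) (α : ℝ) (V : Ω → Fin d → ℝ≥0) {J : Type*} [Fintype J]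
    (x : J → Fin d → ℝ≥0) : Prop :=
  ∀ φ : (Fin d → ℝ≥0) → ℝ≥0, Continuous φ → IsOneHomogeneous φ →
    HasTail P α (fun ω => φ (V ω)) (∑ j, (φ (x j) : ℝ) ^ α)

omit [IsProbabilityMeasure P] in
theorem HasTail.normalize (hα : 0 < α) {X : Ω → ℝ≥0} {k : ℝ≥0} (hk : 0 < k)
    (h : HasTail P α X k) : HasTail P α (fun ω => (k ^ (1 / α))⁻¹ * X ω) 1 := by
  have h1 := h.const_mul hα (k ^ (1 / α))⁻¹
  have h2 : (((k ^ (1 / α))⁻¹ : ℝ≥0) : ℝ) ^ α * k = 1 := by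
    rw [← NNReal.coe_rpow, NNReal.inv_rpow, ← NNReal.rpow_mul, one_div, inv_mul_cancel₀ hα.ne',
      NNReal.rpow_one, NNReal.coe_inv, inv_mul_cancel₀ (NNReal.coe_ne_zero.2 hk.ne')]
  rwa [h2] at h1

end VagueConvergence

end BipartiteRisk

namespace BipartiteRisk

/-! ### Concentration of the tail of `V` on rays -/

section Rays

variable {Ω : Type*} [MeasurableSpace Ω] {P : Measure Ω} [IsProbabilityMeasure P] {α : ℝ} {d : ℕ}

theorem scaleK_apply (K : Fin d → ℝ≥0) (α : ℝ) (x : Fin d → ℝ≥0) (j : Fin d) :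
    scaleK K α x j = K j ^ (1 / α) * x j := by
  simp [scaleK, Matrix.mulVec_diagonal]

theorem toReal_truncate_coe_le (M : ℝ≥0) (x : ℝ≥0) :
    ENNReal.truncateToReal (M : ℝ≥0∞) x ≤ x := by
  rw [ENNReal.truncateToReal]
  exact ENNReal.toReal_mono ENNReal.coe_ne_top (min_le_right _ _)

theorem truncateToReal_le_of_lt {M y : ℝ≥0} {x : ℝ≥0∞} (h : x < y) :
    ENNReal.truncateToReal (M : ℝ≥0∞) x ≤ y := by
  lift x to ℝ≥0 using h.ne_top
  exact (toReal_truncate_coe_le M x).trans (by exact_mod_cast h.le)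

theorem truncateToReal_coe {M x : ℝ≥0} (h : x ≤ M) :
    ENNReal.truncateToReal (M : ℝ≥0∞) x = x := by
  rw [ENNReal.truncateToReal_eq_toReal ENNReal.coe_ne_top (by exact_mod_cast h)]
  simp

theorem AsymptoticallyIndependent.tendsto_both_large (hα : 0 < α) {V : Ω → Fin d → ℝ≥0}
    (hV : Measurable V)
    {K : Fin d → ℝ≥0} (hK : ∀ j, 0 < K j) (hT : ∀ j, HasTail P α (fun ω => V ω j) (K j))
    {N : Seminorm ℝ (Fin d → ℝ)} (hN : IsNorm N) (hN_unit : ∀ j, N (Pi.single j 1) = 1)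
    {μ : Measure (PuncturedOrthant d)} (hμ : IsIntensityMeasure P N V μ)
    (hind : AsymptoticallyIndependent μ) {i j : Fin d} (hij : i ≠ j) {ε : ℝ≥0} (hε : 0 < ε) :
    Tendsto (fun t : ℝ≥0 => (t : ℝ) ^ α * P.real {ω | ε * t < V ω i ∧ ε * t < V ω j})
      atTop (𝓝 0) := by
  have hε' : (0 : ℝ) < ε := hε
  -- Truncation at `ε` keeps the function finite at infinite coordinates, the shift by `ε / 2` makes
  -- it vanish near the origin, and the minimum makes it vanish on the axes. Where both coordinates
  -- are at least `ε` its value is `ε / 2`.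
  set G : (Fin d → ℝ≥0∞) → ℝ := fun x =>
    max 0 (ENNReal.truncateToReal (ε : ℝ≥0∞) (min (x i) (x j)) - ε / 2) with hGdef
  have hGc : Continuous G := by
    refine continuous_const.max (Continuous.sub ?_ continuous_const)
    exact (ENNReal.continuous_truncateToReal ENNReal.coe_ne_top).comp
      ((continuous_apply i).min (continuous_apply j))
  have hGη : ∀ x, (∀ l, x l < ((ε / 2 : ℝ≥0) : ℝ≥0∞)) → G x = 0 := fun x hx => by
    refine max_eq_left ?_
    have := truncateToReal_le_of_lt (M := ε) (lt_of_le_of_lt (min_le_left (x i) (x j)) (hx i))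
    push_cast at this
    linarith
  have hGμ : ∀ᵐ x ∂μ, G x.1 = 0 := by
    have h0 : ∀ᵐ x ∂μ, ¬ ∃ i j, i ≠ j ∧ x.1 i ≠ 0 ∧ x.1 j ≠ 0 := by
      rw [ae_iff]
      simp only [not_not]
      exact hind
    filter_upwards [h0] with x hx
    have h1 : min (x.1 i) (x.1 j) = 0 := by
      by_contra hne
      rw [← ne_eq, ← pos_iff_ne_zero, lt_min_iff] at hne
      exact hx ⟨i, j, hij, hne.1.ne', hne.2.ne'⟩
    simp only [hGdef, h1, ENNReal.truncateToReal, min_zero, ENNReal.toReal_zero]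
    exact max_eq_left (by linarith)
  have key := hμ.tendsto_of_ae_zero hα hV hK hT hN hN_unit hGc (fun x => le_max_left _ _)
    (η := ((ε / 2 : ℝ≥0) : ℝ≥0∞)) (by exact_mod_cast half_pos hε) hGη hGμ (half_pos hε')
  refine tendsto_of_tendsto_of_tendsto_of_le_of_le' tendsto_const_nhds key
    (Eventually.of_forall fun t => by positivity) ?_
  filter_upwards [eventually_gt_atTop 0] with t ht
  refine mul_le_mul_of_nonneg_left (measureReal_mono fun ω hω => ?_) (Real.rpow_nonneg t.2 α)
  have h1 : ε ≤ V ω i / t := (le_div_iff₀ ht).2 hω.1.le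
  have h2 : ε ≤ V ω j / t := (le_div_iff₀ ht).2 hω.2.le
  have h3 : min (ε : ℝ≥0∞) (min ((V ω i / t : ℝ≥0) : ℝ≥0∞) ((V ω j / t : ℝ≥0) : ℝ≥0∞)) = ε := by
    refine min_eq_left (le_min ?_ ?_)
    · exact_mod_cast h1
    · exact_mod_cast h2
  change (ε / 2 : ℝ) ≤ max 0 _
  refine le_trans ?_ (le_max_right _ _)
  simp only [ENNReal.truncateToReal, h3, ENNReal.coe_toReal]
  linarith

/-- The deviation from the ray is unbounded, so each coordinate is truncated before comparison.
Truncation is invisible unless a coordinate is huge, and at scale `t^{-α}` that event has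
arbitrarily small limiting mass. -/
theorem AsymptoticallyFullyDependent.tendsto_off_ray (hα : 0 < α) {V : Ω → Fin d → ℝ≥0}
    (hV : Measurable V)
    {K : Fin d → ℝ≥0} (hK : ∀ j, 0 < K j) (hT : ∀ j, HasTail P α (fun ω => V ω j) (K j))
    {N : Seminorm ℝ (Fin d → ℝ)} (hN : IsNorm N) (hN_unit : ∀ j, N (Pi.single j 1) = 1)
    {μ : Measure (PuncturedOrthant d)} (hμ : IsIntensityMeasure P N V μ)
    (hdep : AsymptoticallyFullyDependent K α μ) (i j : Fin d) {ε : ℝ≥0} (hε : 0 < ε) :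
    Tendsto (fun t : ℝ≥0 => (t : ℝ) ^ α * P.real {ω | (ε * t : ℝ) <
      |(V ω i : ℝ) - (((K j ^ (1 / α))⁻¹ * V ω j : ℝ≥0) : ℝ) * (K i ^ (1 / α) : ℝ≥0)|})
      atTop (𝓝 0) := by
  have hε' : (0 : ℝ) < ε := hε
  have hki : 0 < K i ^ (1 / α) := NNReal.rpow_pos (hK i)
  have hkj : 0 < K j ^ (1 / α) := NNReal.rpow_pos (hK j)
  set r : ℝ≥0 := (K j ^ (1 / α))⁻¹ * K i ^ (1 / α) with hr
  have hr0 : 0 < r := by positivity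
  have hset : ∀ ω, (((K j ^ (1 / α))⁻¹ * V ω j : ℝ≥0) : ℝ) * (K i ^ (1 / α) : ℝ≥0) =
      ((r * V ω j : ℝ≥0) : ℝ) := fun ω => by
    rw [hr]; push_cast; ring
  simp only [hset]
  refine tendsto_order.2 ⟨fun b hb => Eventually.of_forall fun t =>
    hb.trans_le (by positivity), fun b hb => ?_⟩
  -- The truncation level is `m⁻¹`. The displayed sum is the limiting cost of the events `t < m V_i`
  -- and `t < m r V_j`, on whose complement neither coordinate is truncated.
  obtain ⟨m, hmb, hm⟩ : ∃ m : ℝ≥0, (m : ℝ) ^ α * K i + ((m * r : ℝ≥0) : ℝ) ^ α * K j < b ∧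
      0 < m := by
    have hc : Continuous fun m : ℝ≥0 => (m : ℝ) ^ α * K i + ((m * r : ℝ≥0) : ℝ) ^ α * K j := by
      refine Continuous.add (Continuous.mul ?_ continuous_const)
        (Continuous.mul ?_ continuous_const)
      · exact Continuous.rpow_const (by fun_prop) fun _ => Or.inr hα.le
      · exact Continuous.rpow_const (by fun_prop) fun _ => Or.inr hα.le
    have h0 : Tendsto (fun m : ℝ≥0 => (m : ℝ) ^ α * K i + ((m * r : ℝ≥0) : ℝ) ^ α * K j)
        (𝓝[>] 0) (𝓝 0) := by
      have := (hc.tendsto 0).mono_left (nhdsWithin_le_nhds (s := Set.Ioi 0))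
      simpa [Real.zero_rpow hα.ne'] using this
    exact ((h0.eventually (gt_mem_nhds hb)).and self_mem_nhdsWithin).exists
  set T : ℝ≥0∞ → ℝ := ENNReal.truncateToReal ((m⁻¹ : ℝ≥0) : ℝ≥0∞) with hTdef
  have hTc : Continuous T := ENNReal.continuous_truncateToReal ENNReal.coe_ne_top
  set G : (Fin d → ℝ≥0∞) → ℝ := fun x => max 0 (|T (x i) - T (r * x j)| - ε / 2) with hGdef
  have hGc : Continuous G := by
    refine continuous_const.max (Continuous.sub (Continuous.abs (Continuous.sub ?_ ?_))
      continuous_const)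
    · exact hTc.comp (continuous_apply i)
    · exact hTc.comp ((ENNReal.continuous_const_mul ENNReal.coe_ne_top).comp (continuous_apply j))
  -- Below this threshold both truncated quantities lie in `[0, ε/2]`, hence so does their distance.
  have hGη : ∀ x, (∀ l, x l < ((min (ε / 2) (r⁻¹ * (ε / 2)) : ℝ≥0) : ℝ≥0∞)) → G x = 0 :=
    fun x hx => by
    refine max_eq_left ?_
    have h1 : T (x i) ≤ ((ε / 2 : ℝ≥0) : ℝ) := truncateToReal_le_of_lt
      ((hx i).trans_le (by exact_mod_cast min_le_left _ _))
    have h2 : T (r * x j) ≤ ((ε / 2 : ℝ≥0) : ℝ) := by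
      have h3 := (hx j).trans_le (ENNReal.coe_le_coe.2 (min_le_right _ _))
      refine truncateToReal_le_of_lt ?_
      lift x j to ℝ≥0 using h3.ne_top with y
      have h4 : y < r⁻¹ * (ε / 2) := by exact_mod_cast h3
      have h5 : r * y < ε / 2 := by rwa [lt_inv_mul_iff₀ hr0] at h4
      exact_mod_cast h5
    push_cast at h1 h2
    have h3 : 0 ≤ T (x i) := ENNReal.toReal_nonneg
    have h4 : 0 ≤ T (r * x j) := ENNReal.toReal_nonneg
    have : |T (x i) - T (r * x j)| ≤ ε / 2 := abs_le.2 ⟨by linarith, by linarith⟩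
    linarith
  have hGμ : ∀ᵐ x ∂μ, G x.1 = 0 := by
    have h0 : ∀ᵐ x ∂μ, ∃ s : ℝ≥0, 0 < s ∧
        ∀ j, x.1 j = ((s * scaleK K α 1 j : ℝ≥0) : ℝ≥0∞) := ae_iff.2 hdep
    filter_upwards [h0] with x hx
    obtain ⟨s, -, hs⟩ := hx
    have h1 : (r : ℝ≥0∞) * x.1 j = x.1 i := by
      rw [hs, hs, ← ENNReal.coe_mul, scaleK_apply, scaleK_apply, hr]
      congr 1
      simp only [Pi.one_apply, mul_one]
      field_simp
    simp only [hGdef, h1, sub_self, abs_zero]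
    exact max_eq_left (by linarith)
  have key := hμ.tendsto_of_ae_zero hα hV hK hT hN hN_unit hGc (fun x => le_max_left _ _)
    (η := ((min (ε / 2) (r⁻¹ * (ε / 2)) : ℝ≥0) : ℝ≥0∞))
    (by exact_mod_cast lt_min (half_pos hε) (by positivity)) hGη hGμ (half_pos hε')
  have hlim := (((hT i).const_mul hα m).add ((hT j).const_mul hα (m * r))).add key
  rw [add_zero] at hlim
  filter_upwards [hlim.eventually (gt_mem_nhds hmb), eventually_gt_atTop 0] with t hlt ht
  refine lt_of_le_of_lt ?_ hlt
  rw [← mul_add, ← mul_add]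
  refine mul_le_mul_of_nonneg_left ?_ (Real.rpow_nonneg t.2 α)
  refine le_trans (measureReal_mono ?_) ((measureReal_union_le _ _).trans
    (add_le_add_left (measureReal_union_le _ _) _))
  intro ω hω
  by_cases h1 : t < m * V ω i
  · exact Or.inl (Or.inl h1)
  by_cases h2 : t < m * r * V ω j
  · exact Or.inl (Or.inr h2)
  refine Or.inr ?_
  have h3 : V ω i / t ≤ m⁻¹ := by
    rw [div_le_iff₀ ht, le_inv_mul_iff₀ hm]
    exact not_lt.1 h1
  have h4 : r * (V ω j / t) ≤ m⁻¹ := by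
    rw [← mul_div_assoc, div_le_iff₀ ht, le_inv_mul_iff₀ hm, ← mul_assoc]
    exact not_lt.1 h2
  change (ε / 2 : ℝ) ≤ max 0 _
  refine le_trans ?_ (le_max_right _ _)
  have ht' : (0 : ℝ) < t := ht
  have h5 : T ((V ω i / t : ℝ≥0) : ℝ≥0∞) = ((V ω i / t : ℝ≥0) : ℝ) := truncateToReal_coe h3
  have h6 : T (r * ((V ω j / t : ℝ≥0) : ℝ≥0∞)) = ((r * (V ω j / t) : ℝ≥0) : ℝ) := by
    rw [← ENNReal.coe_mul]
    exact truncateToReal_coe h4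
  simp only [h5, h6]
  have h7 : (((V ω i / t : ℝ≥0) : ℝ) - ((r * (V ω j / t) : ℝ≥0) : ℝ)) =
      ((V ω i : ℝ) - ((r * V ω j : ℝ≥0) : ℝ)) / t := by
    push_cast
    ring
  rw [h7, abs_div, abs_of_pos ht']
  have h8 : (ε : ℝ) ≤ |(V ω i : ℝ) - ((r * V ω j : ℝ≥0) : ℝ)| / t :=
    (le_div_iff₀ ht').2 (le_of_lt hω)
  linarith

omit [IsProbabilityMeasure P] in
/-- Finite unions of asymptotically negligible events are negligible. -/
theorem tendsto_measure_iUnion {J : Type*} [Fintype J] {B : J → ℝ≥0 → Set Ω}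
    (h : ∀ j, Tendsto (fun t : ℝ≥0 => (t : ℝ) ^ α * P.real (B j t)) atTop (𝓝 0)) :
    Tendsto (fun t : ℝ≥0 => (t : ℝ) ^ α * P.real (⋃ j, B j t)) atTop (𝓝 0) := by
  have hlim := tendsto_finsetSum Finset.univ fun j _ => h j
  rw [Finset.sum_const_zero] at hlim
  refine tendsto_of_tendsto_of_tendsto_of_le_of_le tendsto_const_nhds hlim
    (fun t => by positivity) fun t => ?_
  simp only
  rw [← Finset.mul_sum]
  gcongr
  exact measureReal_iUnion_fintype_le _

theorem AsymptoticallyIndependent.hasRayTail (hα : 0 < α) {V : Ω → Fin d → ℝ≥0}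
    (hV : Measurable V)
    {K : Fin d → ℝ≥0} (hK : ∀ j, 0 < K j) (hT : ∀ j, HasTail P α (fun ω => V ω j) (K j))
    {N : Seminorm ℝ (Fin d → ℝ)} (hN : IsNorm N) (hN_unit : ∀ j, N (Pi.single j 1) = 1)
    {μ : Measure (PuncturedOrthant d)} (hμ : IsIntensityMeasure P N V μ)
    (hind : AsymptoticallyIndependent μ) :
    HasRayTail P α V fun j => scaleK K α (Pi.single j 1) := by
  intro φ hφc hφ
  obtain ⟨L, hL, hφL⟩ := hφ.exists_le_mul_sum hφc
  have hk : ∀ j, 0 < K j ^ (1 / α) := fun j => NNReal.rpow_pos (hK j)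
  have hVj : ∀ j, Measurable fun ω => V ω j := fun j => (measurable_pi_apply j).comp hV
  refine hasTail_of_sandwich hα (Y := fun j ω => (K j ^ (1 / α))⁻¹ * V ω j)
    (fun j => (hVj j).const_mul _) (fun j => (hT j).normalize hα (hk := hK j)) fun η hη => ?_
  choose ρ hρ hnear using fun j => hφ.exists_near_ray hφc (scaleK K α (Pi.single j 1)) hη
  -- `ε` is chosen so that `t < L (d + 1) V_j` makes `ε t` negligible against `V_j`.
  obtain ⟨ε, hε, hε1, hερ⟩ : ∃ ε : ℝ≥0, 0 < ε ∧ ε * (L * (d + 1)) ≤ 1 ∧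
      ∀ j, ((ε * (L * (d + 1)) * K j ^ (1 / α) : ℝ≥0) : ℝ) ≤ ρ j := by
    have hsmall : ∀ c b : ℝ≥0, 0 < b → ∀ᶠ ε in 𝓝[>] (0 : ℝ≥0), ε * c ≤ b := fun c b hb => by
      have : Tendsto (fun ε : ℝ≥0 => ε * c) (𝓝[>] 0) (𝓝 0) := by
        simpa using ((continuous_id.mul continuous_const).tendsto (0 : ℝ≥0)).mono_left
          (nhdsWithin_le_nhds (s := Set.Ioi 0)) (f := fun ε : ℝ≥0 => id ε * c)
      exact this.eventually (ge_mem_nhds hb)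
    have h1 : ∀ᶠ ε in 𝓝[>] (0 : ℝ≥0),
        ∀ j, ε * (L * (d + 1) * K j ^ (1 / α)) ≤ (ρ j).toNNReal :=
      eventually_all.2 fun j => hsmall _ _ (Real.toNNReal_pos.2 (hρ j))
    obtain ⟨ε, ⟨h2, h3⟩, h4⟩ := ((h1.and (hsmall (L * (d + 1)) 1 one_pos)).and
      self_mem_nhdsWithin).exists
    refine ⟨ε, h4, h3, fun j => ?_⟩
    have := NNReal.coe_le_coe.2 (h2 j)
    rw [Real.coe_toNNReal _ (hρ j).le] at this
    rwa [mul_assoc]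
  refine ⟨fun t => ⋃ p : {p : Fin d × Fin d // p.1 ≠ p.2},
    {ω | ε * t < V ω p.1.1 ∧ ε * t < V ω p.1.2}, fun t => ?_, ?_, fun t ω hω => ?_⟩
  · have h1 : ∀ j, MeasurableSet {ω | ε * t < V ω j} := fun j =>
      measurableSet_lt measurable_const (hVj j)
    exact MeasurableSet.iUnion fun p => (h1 p.1.1).inter (h1 p.1.2)
  · exact tendsto_measure_iUnion fun p =>
      hind.tendsto_both_large hα hV hK hT hN hN_unit hμ p.2 hε
  have hω' : ∀ i j, i ≠ j → ε * t < V ω j → V ω i ≤ ε * t := fun i j hij hj => by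
    by_contra hi
    exact hω (Set.mem_iUnion.2 ⟨⟨(i, j), hij⟩, not_le.1 hi, hj⟩)
  have hkV : ∀ j, V ω j = (K j ^ (1 / α))⁻¹ * V ω j * K j ^ (1 / α) := fun j => by
    rw [mul_right_comm, inv_mul_cancel₀ (hk j).ne', one_mul]
  have hlarge : ∀ j, t < L * (d + 1) * V ω j → ε * t < V ω j := fun j hj => by
    calc ε * t < ε * (L * (d + 1) * V ω j) := by gcongr
      _ = ε * (L * (d + 1)) * V ω j := by ring
      _ ≤ 1 * V ω j := by gcongr
      _ = V ω j := one_mul _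
  -- When `V_j` is large, every other coordinate is at most `ε t`, so `V` lies within relative
  -- distance `ρ j` of the `j`-th ray.
  have hclose := fun j (hj : t < L * (d + 1) * V ω j) =>
    hnear j ((K j ^ (1 / α))⁻¹ * V ω j) (V ω) fun i => by
      rcases eq_or_ne i j with rfl | hij
      · rw [scaleK_apply, Pi.single_eq_same, mul_one, ← NNReal.coe_mul, ← hkV, sub_self, abs_zero]
        exact mul_nonneg (hρ i).le (NNReal.coe_nonneg _)
      · rw [scaleK_apply, Pi.single_eq_of_ne hij, mul_zero, NNReal.coe_zero, mul_zero, sub_zero,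
          NNReal.abs_eq]
        have h1 : V ω i ≤ ε * (L * (d + 1)) * K j ^ (1 / α) * ((K j ^ (1 / α))⁻¹ * V ω j) := by
          calc V ω i ≤ ε * t := hω' i j hij (hlarge j hj)
            _ ≤ ε * (L * (d + 1) * V ω j) := by gcongr
            _ = ε * (L * (d + 1) * ((K j ^ (1 / α))⁻¹ * V ω j * K j ^ (1 / α))) := by rw [← hkV]
            _ = _ := by ring
        calc (V ω i : ℝ) ≤ _ := NNReal.coe_le_coe.2 h1
          _ = _ := NNReal.coe_mul _ _
          _ ≤ _ := by gcongr; exact hερ j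
  -- The factor `d + 1` dominates both the `1` needed here and the `d` from the pigeonhole step
  -- below, so one largeness threshold serves both directions.
  have hlower : ∀ j, t < (φ (scaleK K α (Pi.single j 1)) - η) * ((K j ^ (1 / α))⁻¹ * V ω j) →
      t < L * (d + 1) * V ω j := fun j hj => by
    refine hj.trans_le ?_
    calc (φ (scaleK K α (Pi.single j 1)) - η) * ((K j ^ (1 / α))⁻¹ * V ω j)
        ≤ (L * K j ^ (1 / α)) * ((K j ^ (1 / α))⁻¹ * V ω j) := by
          gcongr
          refine tsub_le_self.trans ((hφL _).trans ?_)
          gcongr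
          simp [scaleK_apply, Pi.single_apply]
      _ = L * ((K j ^ (1 / α))⁻¹ * V ω j * K j ^ (1 / α)) := by ring
      _ = L * 1 * V ω j := by rw [← hkV, mul_one]
      _ ≤ L * (d + 1) * V ω j := by gcongr; exact le_add_self
  refine ⟨fun ht => ?_, fun j hj => ⟨hj.trans_le (hclose j (hlower j hj)).2, fun i hi => ?_⟩⟩
  · have h1 := ht.trans_le (hφL (V ω))
    rw [Finset.mul_sum] at h1
    obtain ⟨j, hj⟩ := exists_lt_card_mul h1
    refine ⟨j, ht.trans_le (hclose j (hj.trans_le ?_)).1⟩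
    calc (d : ℝ≥0) * (L * V ω j) = L * d * V ω j := by ring
      _ ≤ L * (d + 1) * V ω j := by gcongr; exact le_self_add
  · by_contra hij
    exact absurd (hlarge i (hlower i hi)) (not_lt.2 (hω' i j hij (hlarge j (hlower j hj))))

theorem AsymptoticallyFullyDependent.hasRayTail (hα : 0 < α) {V : Ω → Fin d → ℝ≥0}
    (hV : Measurable V)
    {K : Fin d → ℝ≥0} (hK : ∀ j, 0 < K j) (hT : ∀ j, HasTail P α (fun ω => V ω j) (K j))
    {N : Seminorm ℝ (Fin d → ℝ)} (hN : IsNorm N) (hN_unit : ∀ j, N (Pi.single j 1) = 1)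
    {μ : Measure (PuncturedOrthant d)} (hμ : IsIntensityMeasure P N V μ)
    (hdep : AsymptoticallyFullyDependent K α μ) :
    HasRayTail P α V fun _ : Unit => scaleK K α 1 := by
  intro φ hφc hφ
  obtain ⟨L, hL, hφL⟩ := hφ.exists_le_mul_sum hφc
  obtain ⟨j₀⟩ := hμ.nonempty_fin
  have hVj : ∀ j, Measurable fun ω => V ω j := fun j => (measurable_pi_apply j).comp hV
  set s : Ω → ℝ≥0 := fun ω => (K j₀ ^ (1 / α))⁻¹ * V ω j₀ with hs
  have hsm : Measurable s := (hVj j₀).const_mul _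
  refine hasTail_of_sandwich hα (Y := fun _ : Unit => s)
    (fun _ => hsm) (fun _ => (hT j₀).normalize hα (hK j₀)) fun η hη => ?_
  obtain ⟨ρ, hρ, hnear⟩ := hφ.exists_near_ray hφc (scaleK K α 1) hη
  set k : ℝ≥0 := ∑ j, K j ^ (1 / α) with hkdef
  -- The factor 2 leaves room for the error: `2t < D V_i ≤ D s K_i^{1/α} + ε D t` with `ε D ≤ 1`
  -- still gives `t < D s K_i^{1/α}`.
  set D : ℝ≥0 := 2 * (L * (d + 1)) with hD
  have hk1 : ∀ j, K j ^ (1 / α) ≤ k := fun j =>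
    Finset.single_le_sum (f := fun j => K j ^ (1 / α)) (fun _ _ => zero_le) (Finset.mem_univ j)
  have hk : 0 < k := (NNReal.rpow_pos (hK j₀)).trans_le (hk1 j₀)
  have hD0 : 0 < D := by positivity
  -- On the good event `t < D k s` and `ε t` is negligible against `s`.
  obtain ⟨ε, hε, hε1, hερ⟩ : ∃ ε : ℝ≥0, 0 < ε ∧ ε * D ≤ 1 ∧ ((ε * (D * k) : ℝ≥0) : ℝ) ≤ ρ := by
    refine ⟨min D⁻¹ (ρ.toNNReal * (D * k)⁻¹),
      lt_min (by positivity) (mul_pos (Real.toNNReal_pos.2 hρ) (by positivity)), ?_, ?_⟩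
    · calc _ ≤ D⁻¹ * D := by gcongr; exact min_le_left _ _
        _ = 1 := inv_mul_cancel₀ hD0.ne'
    · rw [← Real.le_toNNReal_iff_coe_le hρ.le]
      calc _ ≤ ρ.toNNReal * (D * k)⁻¹ * (D * k) := by gcongr; exact min_le_right _ _
        _ = ρ.toNNReal := inv_mul_cancel_right₀ (by positivity) _
  refine ⟨fun t => ⋃ i, {ω | (ε * t : ℝ) <
      |(V ω i : ℝ) - (s ω : ℝ) * (K i ^ (1 / α) : ℝ≥0)|}, fun t => ?_, ?_, fun t ω hω => ?_⟩
  · refine MeasurableSet.iUnion fun i => measurableSet_lt measurable_const ?_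
    have h1 : Measurable fun ω => (V ω i : ℝ) := (hVj i).coe_nnreal_real
    have h2 : Measurable fun ω => (s ω : ℝ) := hsm.coe_nnreal_real
    exact (h1.sub (h2.mul_const _)).abs
  · exact tendsto_measure_iUnion fun i =>
      hdep.tendsto_off_ray hα hV hK hT hN hN_unit hμ i j₀ hε
  have hω' : ∀ i, |(V ω i : ℝ) - (s ω : ℝ) * (K i ^ (1 / α) : ℝ≥0)| ≤ ε * t := fun i => by
    by_contra hi
    exact hω (Set.mem_iUnion.2 ⟨i, not_le.1 hi⟩)
  have hclose := fun (hst : t < D * k * s ω) => hnear (s ω) (V ω) fun i => by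
    rw [scaleK_apply, Pi.one_apply, mul_one]
    refine (hω' i).trans ?_
    have h1 : ε * t ≤ ε * (D * k) * s ω := by
      rw [mul_assoc]
      gcongr
    calc (ε : ℝ) * t ≤ ((ε * (D * k) : ℝ≥0) : ℝ) * s ω := by exact_mod_cast h1
      _ ≤ ρ * s ω := by gcongr
  refine ⟨fun ht => ⟨(), ht.trans_le (hclose ?_).1⟩, fun _ hj =>
    ⟨hj.trans_le (hclose ?_).2, fun _ _ => rfl⟩⟩
  · have h1 := ht.trans_le (hφL (V ω))
    rw [Finset.mul_sum] at h1
    obtain ⟨i, hi⟩ := exists_lt_card_mul h1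
    have h2 : (2 : ℝ) * t < D * V ω i := by
      have : t < L * (d + 1) * V ω i := hi.trans_le (by
        calc (d : ℝ≥0) * (L * V ω i) = L * d * V ω i := by ring
          _ ≤ L * (d + 1) * V ω i := by gcongr; exact le_self_add)
      have h3 : (t : ℝ) < L * (d + 1) * V ω i := by exact_mod_cast this
      rw [hD]
      push_cast
      linarith
    have h3 : (V ω i : ℝ) ≤ s ω * (K i ^ (1 / α) : ℝ≥0) + ε * t := by
      linarith [(abs_le.1 (hω' i)).2]
    have h4 : (ε : ℝ) * D ≤ 1 := by exact_mod_cast hε1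
    have h5 : (D : ℝ) * V ω i ≤ D * (s ω * (K i ^ (1 / α) : ℝ≥0)) + t := by
      calc (D : ℝ) * V ω i ≤ D * (s ω * (K i ^ (1 / α) : ℝ≥0) + ε * t) := by gcongr
        _ = D * (s ω * (K i ^ (1 / α) : ℝ≥0)) + ε * D * t := by ring
        _ ≤ D * (s ω * (K i ^ (1 / α) : ℝ≥0)) + 1 * t := by gcongr
        _ = _ := by ring
    have h6 : (t : ℝ) < D * (s ω * (K i ^ (1 / α) : ℝ≥0)) := by linarith
    have h7 : t < D * (s ω * K i ^ (1 / α)) := by exact_mod_cast h6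
    calc t < D * (s ω * K i ^ (1 / α)) := h7
      _ ≤ D * (s ω * k) := by gcongr; exact hk1 i
      _ = D * k * s ω := by ring
  · calc t < (φ (scaleK K α 1) - η) * s ω := hj
      _ ≤ (L * k) * s ω := by
        gcongr
        refine tsub_le_self.trans ((hφL _).trans_eq ?_)
        simp [scaleK_apply, hkdef]
      _ = L * 1 * k * s ω := by ring
      _ ≤ L * (2 * (d + 1)) * k * s ω := by
        gcongr
        calc (1 : ℝ≥0) ≤ 2 * 1 := by norm_num
          _ ≤ 2 * (d + 1) := by gcongr; exact le_add_self
      _ = D * k * s ω := by rw [hD]; ring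

end Rays

end BipartiteRisk

namespace BipartiteRisk

/-! ### Random weights and the conditional probability -/

section RandomWeights

variable {Ω : Type*} [MeasurableSpace Ω] {P : Measure Ω} [IsProbabilityMeasure P] {α : ℝ} {q d : ℕ}

theorem IsOneHomogeneous.comp_mulVec {m : (Fin q → ℝ≥0) → ℝ≥0} (hm : IsOneHomogeneous m)
    (a : Matrix (Fin q) (Fin d) ℝ≥0) : IsOneHomogeneous fun v : Fin d → ℝ≥0 => m (a *ᵥ v) := by
  intro c v hc
  simp only [Matrix.mulVec_smul]
  exact hm c _ hc

theorem coe_rpow_mul_measure (S : Set Ω) (t : ℝ≥0) :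
    ((t ^ α : ℝ≥0) : ℝ≥0∞) * P S = ENNReal.ofReal ((t : ℝ) ^ α * P.real S) := by
  rw [ENNReal.ofReal_mul (by positivity), ofReal_measureReal, ← NNReal.coe_rpow,
    ENNReal.ofReal_coe_nnreal]

theorem continuous_mulVec_uncurried {m : (Fin q → ℝ≥0) → ℝ≥0} (hmc : Continuous m) :
    Continuous fun p : (Fin q → Fin d → ℝ≥0) × (Fin d → ℝ≥0) => m (Matrix.of p.1 *ᵥ p.2) := by
  refine hmc.comp (continuous_pi fun i => ?_)
  simp only [Matrix.mulVec, dotProduct, Matrix.of_apply]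
  fun_prop

theorem measurable_rpow_mulVec {m : (Fin q → ℝ≥0) → ℝ≥0} (hmc : Continuous m) (hα : 0 ≤ α)
    {A : Ω → Fin q → Fin d → ℝ≥0} (hA : Measurable A) (x : Fin d → ℝ≥0) :
    Measurable fun ω => ((m (Matrix.of (A ω) *ᵥ x) ^ α : ℝ≥0) : ℝ≥0∞) := by
  have h : Continuous fun a : Fin q → Fin d → ℝ≥0 => m (Matrix.of a *ᵥ x) ^ α :=
    (NNReal.continuous_rpow_const hα).comp
      ((continuous_mulVec_uncurried hmc).comp (continuous_id.prodMk continuous_const))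
  exact (h.measurable.comp hA).coe_nnreal_ennreal

theorem mulVec_sum_le (a : Fin q → Fin d → ℝ≥0) (v : Fin d → ℝ≥0) :
    ∑ i, (Matrix.of a *ᵥ v) i ≤ (∑ i, ∑ j, a i j) * ∑ j, v j := by
  rw [Finset.sum_mul]
  refine Finset.sum_le_sum fun i _ => ?_
  rw [Finset.sum_mul]
  change ∑ j, a i j * v j ≤ _
  refine Finset.sum_le_sum fun j _ => ?_
  have h : v j ≤ ∑ l, v l :=
    Finset.single_le_sum (f := v) (fun _ _ => zero_le) (Finset.mem_univ j)
  exact mul_le_mul_of_nonneg_left h zero_le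

theorem tail_le_of_le_mul (hα : 0 < α) {X S : Ω → ℝ≥0} {B c : ℝ≥0}
    (hB : ∀ t : ℝ≥0, (t : ℝ) ^ α * P.real {ω | t < S ω} ≤ B) (hX : ∀ ω, X ω ≤ c * S ω) (t : ℝ≥0) :
    (t : ℝ) ^ α * P.real {ω | t < X ω} ≤ (c : ℝ) ^ α * B := by
  rcases eq_or_ne c 0 with rfl | hc
  · have : {ω | t < X ω} = ∅ := by
      ext ω
      simpa using (hX ω).trans (by simp : 0 * S ω ≤ t)
    simp [this, Real.zero_rpow hα.ne']
  have hc' : 0 < c := pos_iff_ne_zero.2 hc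
  have hcα : 0 < (c : ℝ) ^ α := Real.rpow_pos_of_pos hc' α
  calc (t : ℝ) ^ α * P.real {ω | t < X ω} ≤ (t : ℝ) ^ α * P.real {ω | t / c < S ω} := by
        refine mul_le_mul_of_nonneg_left (measureReal_mono fun ω hω => ?_) (Real.rpow_nonneg t.2 α)
        exact (div_lt_iff₀' hc').2 (lt_of_lt_of_le hω (hX ω))
    _ = (c : ℝ) ^ α * (((t / c : ℝ≥0) : ℝ) ^ α * P.real {ω | t / c < S ω}) := by
        rw [NNReal.coe_div, Real.div_rpow t.coe_nonneg c.coe_nonneg]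
        field_simp
    _ ≤ (c : ℝ) ^ α * B := by gcongr; exact hB _

/-- A multivariate version of Breiman's lemma: independent random weights may be averaged out
in the tail. -/
theorem HasRayTail.tendsto_mulVec (hα : 0 < α) {V : Ω → Fin d → ℝ≥0} (hV : Measurable V)
    {J : Type*} [Fintype J] {x : J → Fin d → ℝ≥0} (hray : HasRayTail P α V x) {B : ℝ≥0}
    (hB : ∀ t : ℝ≥0, (t : ℝ) ^ α * P.real {ω | t < ∑ j, V ω j} ≤ B)
    {A : Ω → Fin q → Fin d → ℝ≥0} (hA : Measurable A) (hindep : IndepFun A V P)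
    (hmoment : ∫⁻ ω, (((∑ i, ∑ j, A ω i j) ^ α : ℝ≥0) : ℝ≥0∞) ∂P ≠ ⊤)
    {m : (Fin q → ℝ≥0) → ℝ≥0} (hmc : Continuous m) (hm : IsOneHomogeneous m) :
    Tendsto (fun t : ℝ≥0 => ((t ^ α : ℝ≥0) : ℝ≥0∞) * P {ω | t < m (Matrix.of (A ω) *ᵥ V ω)})
      atTop (𝓝 (∑ j, ∫⁻ ω, ((m (Matrix.of (A ω) *ᵥ x j) ^ α : ℝ≥0) : ℝ≥0∞) ∂P)) ∧
    (∑ j, ∫⁻ ω, ((m (Matrix.of (A ω) *ᵥ x j) ^ α : ℝ≥0) : ℝ≥0∞) ∂P) ≠ ⊤ := by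
  obtain ⟨L, -, hmL⟩ := hm.exists_le_mul_sum hmc
  have hmA : ∀ (a : Fin q → Fin d → ℝ≥0) (v : Fin d → ℝ≥0),
      m (Matrix.of a *ᵥ v) ≤ L * (∑ i, ∑ j, a i j) * ∑ j, v j := fun a v => by
    refine (hmL _).trans ?_
    rw [mul_assoc]
    gcongr
    exact mulVec_sum_le a v
  have hpm := fun j => measurable_rpow_mulVec hmc hα.le hA (x j)
  have hSm : ∀ t : ℝ≥0, MeasurableSet {p : (Fin q → Fin d → ℝ≥0) × (Fin d → ℝ≥0) |
      t < m (Matrix.of p.1 *ᵥ p.2)} := fun t =>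
    measurableSet_lt measurable_const (continuous_mulVec_uncurried hmc).measurable
  -- Independence makes the joint law a product, so Fubini averages over `A` the tail for a frozen
  -- matrix.
  have hfub : ∀ t : ℝ≥0, P {ω | t < m (Matrix.of (A ω) *ᵥ V ω)} =
      ∫⁻ ω, P {ω' | t < m (Matrix.of (A ω) *ᵥ V ω')} ∂P := fun t => by
    have : IsProbabilityMeasure (P.map V) := Measure.isProbabilityMeasure_map hV.aemeasurable
    have h1 := (indepFun_iff_map_prod_eq_prod_map_map hA.aemeasurable hV.aemeasurable).1 hindep
    have h2 := congrArg (fun ν => ν {p : (Fin q → Fin d → ℝ≥0) × (Fin d → ℝ≥0) |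
      t < m (Matrix.of p.1 *ᵥ p.2)}) h1
    rw [Measure.map_apply (hA.prodMk hV) (hSm t), Measure.prod_apply (hSm t),
      lintegral_map (measurable_measure_prodMk_left (hSm t)) hA] at h2
    refine h2.trans (lintegral_congr fun ω => ?_)
    rw [Measure.map_apply hV (measurable_prodMk_left (hSm t))]
    rfl
  have hmeas : ∀ t : ℝ≥0, Measurable fun ω => P {ω' | t < m (Matrix.of (A ω) *ᵥ V ω')} := fun t => by
    have h := (measurable_measure_prodMk_left (ν := P.map V) (hSm t)).comp hA
    convert h using 2 with ω
    simp only [Function.comp_apply]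
    rw [Measure.map_apply hV (measurable_prodMk_left (hSm t))]
    rfl
  have hc : (((L ^ α * B : ℝ≥0)) : ℝ≥0∞) ≠ ⊤ := ENNReal.coe_ne_top
  constructor
  · rw [← lintegral_finsetSum _ fun j _ => hpm j]
    simp only [hfub]
    simp_rw [← lintegral_const_mul _ (hmeas _)]
    -- As the tail bound `B` is uniform in `t`, the `α`-th moment of the weights suffices for
    -- domination.
    refine tendsto_lintegral_filter_of_dominated_convergence
      (fun ω => ((L ^ α * B : ℝ≥0) : ℝ≥0∞) * (((∑ i, ∑ j, A ω i j) ^ α : ℝ≥0) : ℝ≥0∞))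
      (Eventually.of_forall fun t => (hmeas t).const_mul _)
      (Eventually.of_forall fun t => ae_of_all _ fun ω => ?_) ?_ (ae_of_all _ fun ω => ?_)
    · rw [coe_rpow_mul_measure]
      refine ENNReal.ofReal_le_of_le_toReal ?_
      refine (tail_le_of_le_mul hα hB (fun ω' => hmA (A ω) (V ω')) t).trans_eq ?_
      rw [← ENNReal.coe_mul, ENNReal.coe_toReal, ← NNReal.coe_rpow, ← NNReal.coe_mul,
        NNReal.mul_rpow]
      congr 1
      ring
    · rw [lintegral_const_mul' _ _ hc]
      exact ENNReal.mul_ne_top hc hmoment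
    · have h1 := hray (fun v => m (Matrix.of (A ω) *ᵥ v))
        ((continuous_mulVec_uncurried hmc).comp (continuous_const.prodMk continuous_id))
        (hm.comp_mulVec _)
      have h2 := ENNReal.tendsto_ofReal h1
      simp only [← coe_rpow_mul_measure] at h2
      refine h2.trans_eq ?_
      congr 1
      rw [ENNReal.ofReal_sum_of_nonneg fun _ _ => by positivity]
      refine Finset.sum_congr rfl fun j _ => ?_
      rw [← NNReal.coe_rpow, ENNReal.ofReal_coe_nnreal]
  · refine (ENNReal.sum_lt_top.2 fun j _ => ?_).ne
    have hc' : ((((L * ∑ l, x j l) ^ α : ℝ≥0)) : ℝ≥0∞) ≠ ⊤ := ENNReal.coe_ne_top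
    refine lt_of_le_of_lt (lintegral_mono (g := fun ω => (((L * ∑ l, x j l) ^ α : ℝ≥0) : ℝ≥0∞) *
      (((∑ i, ∑ j, A ω i j) ^ α : ℝ≥0) : ℝ≥0∞)) fun ω => ?_) ?_
    · simp only
      rw [← ENNReal.coe_mul, ENNReal.coe_le_coe, ← NNReal.mul_rpow]
      refine NNReal.rpow_le_rpow ((hmA _ _).trans_eq ?_) hα.le
      ring
    · rw [lintegral_const_mul' _ _ hc']
      exact ENNReal.mul_lt_top hc'.lt_top hmoment.lt_top

theorem HasRayTail.tendsto_cond (hα : 0 < α) {V : Ω → Fin d → ℝ≥0} (hV : Measurable V)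
    {J : Type*} [Fintype J] {x : J → Fin d → ℝ≥0} (hray : HasRayTail P α V x) {B : ℝ≥0}
    (hB : ∀ t : ℝ≥0, (t : ℝ) ^ α * P.real {ω | t < ∑ j, V ω j} ≤ B)
    {A : Ω → Fin q → Fin d → ℝ≥0} (hA : Measurable A) (hindep : IndepFun A V P)
    (hmoment : ∫⁻ ω, (((∑ i, ∑ j, A ω i j) ^ α : ℝ≥0) : ℝ≥0∞) ∂P ≠ ⊤)
    {g h : (Fin q → ℝ≥0) → ℝ≥0} (hg : Continuous g) (hh : Continuous h)
    (hg_hom : IsOneHomogeneous g) (hh_hom : IsOneHomogeneous h) {u : ℝ≥0} (hu : 0 < u)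
    {C : ℝ≥0∞}
    (hC : C = ∑ j, ∫⁻ ω, ((h (Matrix.of (A ω) *ᵥ x j) ^ α : ℝ≥0) : ℝ≥0∞) ∂P) (hC0 : C ≠ 0) :
    C ≠ ⊤ ∧ Tendsto (fun t : ℝ≥0 => cond P {ω | u * t < h (Matrix.of (A ω) *ᵥ V ω)}
        {ω | t < g (Matrix.of (A ω) *ᵥ V ω)}) atTop
      (𝓝 (C⁻¹ * ∑ j, ∫⁻ ω, ((min (h (Matrix.of (A ω) *ᵥ x j) ^ α)
        (u ^ α * g (Matrix.of (A ω) *ᵥ x j) ^ α) : ℝ≥0) : ℝ≥0∞) ∂P)) := by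
  obtain ⟨hlim, htop⟩ := hray.tendsto_mulVec hα hV hB hA hindep hmoment hh hh_hom
  rw [← hC] at hlim htop
  refine ⟨htop, ?_⟩
  have hmin_hom : IsOneHomogeneous fun y => min (h y) (u * g y) := fun a y ha => by
    simp only [hh_hom a y ha, hg_hom a y ha]
    rw [mul_min, mul_left_comm]
  obtain ⟨hlim', htop'⟩ := hray.tendsto_mulVec hα hV hB hA hindep hmoment
    (m := fun y => min (h y) (u * g y)) (hh.min (continuous_const.mul hg)) hmin_hom
  have hE : ∀ j, ∫⁻ ω, ((min (h (Matrix.of (A ω) *ᵥ x j) ^ α)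
        (u ^ α * g (Matrix.of (A ω) *ᵥ x j) ^ α) : ℝ≥0) : ℝ≥0∞) ∂P =
      ∫⁻ ω, ((min (h (Matrix.of (A ω) *ᵥ x j)) (u * g (Matrix.of (A ω) *ᵥ x j)) ^ α : ℝ≥0) :
        ℝ≥0∞) ∂P := fun j => by
    refine lintegral_congr fun ω => ?_
    rw [← NNReal.mul_rpow, (NNReal.monotone_rpow_of_nonneg hα.le).map_min]
  simp only [hE]
  have hscale : Tendsto (fun t : ℝ≥0 => u * t) atTop atTop :=
    tendsto_id.const_mul_atTop hu
  -- Both tails are taken at level `u t`, so the factors `(u t)^α` cancel in the quotient.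
  have hratio := (ENNReal.Tendsto.mul (tendsto_inv_iff.2 hlim) (Or.inr htop') hlim'
    (Or.inr (ENNReal.inv_ne_top.2 hC0))).comp hscale
  refine hratio.congr' ?_
  filter_upwards [eventually_gt_atTop 0] with t ht
  have hFm : Measurable fun ω => h (Matrix.of (A ω) *ᵥ V ω) :=
    (continuous_mulVec_uncurried hh).measurable.comp (hA.prodMk hV)
  rw [cond_apply (measurableSet_lt measurable_const hFm)]
  have hset : {ω | u * t < h (Matrix.of (A ω) *ᵥ V ω)} ∩ {ω | t < g (Matrix.of (A ω) *ᵥ V ω)} =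
      {ω | u * t < min (h (Matrix.of (A ω) *ᵥ V ω)) (u * g (Matrix.of (A ω) *ᵥ V ω))} := by
    ext ω
    simp [hu]
  rw [hset]
  have hT0 : (((u * t) ^ α : ℝ≥0) : ℝ≥0∞) ≠ 0 :=
    ENNReal.coe_ne_zero.2 (NNReal.rpow_pos (mul_pos hu ht)).ne'
  have hTt : (((u * t) ^ α : ℝ≥0) : ℝ≥0∞) ≠ ⊤ := ENNReal.coe_ne_top
  simp only [Function.comp_apply]
  rw [ENNReal.mul_inv (Or.inl hT0) (Or.inl hTt), mul_mul_mul_comm, ENNReal.inv_mul_cancel hT0 hTt,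
    one_mul]

theorem IsNorm.moment_ne_top (hα : 0 < α) {M : Seminorm ℝ (Matrix (Fin q) (Fin d) ℝ)}
    (hM : IsNorm M) {W : Ω → Matrix (Fin q) (Fin d) ℝ≥0} {δ : ℝ} (hδ : 0 < δ)
    (hW : ∫⁻ ω, ENNReal.ofReal (M ((W ω).map (fun x => (x : ℝ))) ^ (α + δ)) ∂P < ⊤) :
    ∫⁻ ω, (((∑ i, ∑ j, W ω i j) ^ α : ℝ≥0) : ℝ≥0∞) ∂P ≠ ⊤ := by
  obtain ⟨C, -, hC⟩ := IsNorm.exists_norm_le (E := Fin q → Fin d → ℝ) (N := M) hM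
  have hsum : ∀ w : Matrix (Fin q) (Fin d) ℝ≥0,
      ((∑ i, ∑ j, w i j : ℝ≥0) : ℝ) ≤ (q * d * C : ℝ≥0) * M (w.map (fun x => (x : ℝ))) := by
    intro w
    have h1 : ∀ i j, (w i j : ℝ) ≤ C * M (w.map (fun x => (x : ℝ))) := fun i j => by
      refine le_trans ?_ (hC (w.map (fun x => (x : ℝ))))
      have h2 := norm_le_pi_norm (fun i j => (w i j : ℝ)) i
      have h3 := norm_le_pi_norm (fun j => (w i j : ℝ)) j
      have h4 : ‖(w i j : ℝ)‖ = w i j := Real.norm_of_nonneg (NNReal.coe_nonneg _)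
      rw [h4] at h3
      exact h3.trans h2
    push_cast
    calc ∑ i, ∑ j, (w i j : ℝ) ≤ ∑ _i : Fin q, ∑ _j : Fin d, C * M (w.map (fun x => (x : ℝ))) :=
          Finset.sum_le_sum fun i _ => Finset.sum_le_sum fun j _ => h1 i j
      _ = _ := by simp; ring
  set c : ℝ≥0 := q * d * C
  have hc : ((c ^ α : ℝ≥0) : ℝ≥0∞) ≠ ⊤ := ENNReal.coe_ne_top
  refine ne_top_of_le_ne_top ?_ (lintegral_mono (g := fun ω => ((c ^ α : ℝ≥0) : ℝ≥0∞) *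
    (1 + ENNReal.ofReal (M ((W ω).map (fun x => (x : ℝ))) ^ (α + δ)))) fun ω => ?_)
  · rw [lintegral_const_mul' _ _ hc, lintegral_add_left measurable_const]
    refine ENNReal.mul_ne_top hc (ENNReal.add_ne_top.2 ⟨by simp, hW.ne⟩)
  · set y := M ((W ω).map (fun x => (x : ℝ))) with hy
    have hy0 : 0 ≤ y := apply_nonneg M _
    -- On a probability space the higher moment controls the lower one through this pointwise bound.
    have h1 : y ^ α ≤ 1 + y ^ (α + δ) := by
      rcases le_total y 1 with h | h
      · exact (Real.rpow_le_one hy0 h hα.le).trans (by linarith [Real.rpow_nonneg hy0 (α + δ)])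
      · have := Real.rpow_le_rpow_of_exponent_le h (le_add_of_nonneg_right hδ.le : α ≤ α + δ)
        linarith
    have h2 : (((∑ i, ∑ j, W ω i j) ^ α : ℝ≥0) : ℝ) ≤ (c ^ α : ℝ≥0) * (1 + y ^ (α + δ)) := by
      rw [NNReal.coe_rpow, NNReal.coe_rpow]
      calc _ ≤ ((c : ℝ) * y) ^ α := Real.rpow_le_rpow (NNReal.coe_nonneg _) (hsum _) hα.le
        _ = (c : ℝ) ^ α * y ^ α := Real.mul_rpow c.coe_nonneg hy0
        _ ≤ _ := by gcongr
    simp only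
    rw [← ENNReal.ofReal_coe_nnreal, ← ENNReal.ofReal_coe_nnreal (p := c ^ α), ← ENNReal.ofReal_one,
      ← ENNReal.ofReal_add zero_le_one (Real.rpow_nonneg hy0 _),
      ← ENNReal.ofReal_mul (NNReal.coe_nonneg _)]
    exact ENNReal.ofReal_le_ofReal h2

end RandomWeights

/-- The factor `K_j` is `(K_j^{1/α})^α`, absorbed into `h^α` by homogeneity; this matches the
constant to the points on the rays. -/
theorem constInd_eq {Ω : Type*} [MeasurableSpace Ω] (P : Measure Ω) {q d : ℕ} {α : ℝ} (hα : 0 < α)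
    (A : Ω → Matrix (Fin q) (Fin d) ℝ≥0) (K : Fin d → ℝ≥0) {h : (Fin q → ℝ≥0) → ℝ≥0}
    (hh : IsOneHomogeneous h) : constInd P A K α h =
      ∑ j, ∫⁻ ω, ((h (A ω *ᵥ scaleK K α (Pi.single j 1)) ^ α : ℝ≥0) : ℝ≥0∞) ∂P := by
  refine Finset.sum_congr rfl fun j _ => ?_
  rw [← lintegral_const_mul' _ _ ENNReal.coe_ne_top]
  refine lintegral_congr fun ω => ?_
  have h1 : scaleK K α (Pi.single j 1) = (K j ^ (1 / α)) • Pi.single j (1 : ℝ≥0) := by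
    ext i
    rcases eq_or_ne i j with rfl | hij
    · simp [scaleK_apply]
    · simp [scaleK_apply, hij]
  rw [h1, Matrix.mulVec_smul, hh.map_smul, NNReal.mul_rpow, ← NNReal.rpow_mul, one_div,
    inv_mul_cancel₀ hα.ne', NNReal.rpow_one, ENNReal.coe_mul]

theorem measurable_weightedAdjacency {q d : ℕ} : Measurable
    fun p : (Fin q → Fin d → ℝ≥0) × (Fin q → Fin d → Prop) =>
      fun i j => weightedAdjacency (fun p : (Fin q → Fin d → ℝ≥0) × (Fin q → Fin d → Prop) =>
        Matrix.of p.1) (fun p => p.2) p i j := by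
  classical
  refine measurable_pi_lambda _ fun i => measurable_pi_lambda _ fun j => ?_
  simp only [weightedAdjacency, Matrix.of_apply]
  refine Measurable.ite ?_ (by fun_prop) measurable_const
  exact measurableSet_setOfPred.2 (by fun_prop)

end BipartiteRisk
theorem corollary3p4 {Ω : Type*} [MeasurableSpace Ω] (P : Measure Ω) [IsProbabilityMeasure P]
    {q d : ℕ} (α : ℝ) (hα : 0 < α) (K : Fin d → ℝ≥0) (hK : ∀ j, 0 < K j)
    -- the losses, with Pareto tails
    (V : Ω → Fin d → ℝ≥0) (hV : Measurable V)
    (hPareto : ∀ j, Asymptotics.IsEquivalent atTop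
      (fun t : ℝ≥0 => P.real {ω | t < V ω j}) (fun t : ℝ≥0 => (K j : ℝ) * (t : ℝ) ^ (-α)))
    -- regular variation of the losses, for a reference norm with `‖e_j‖ = 1`
    (N : Seminorm ℝ (Fin d → ℝ)) (hN : BipartiteRisk.IsNorm N)
    (hN_unit : ∀ j, N (Pi.single j 1) = 1)
    (μ : Measure (BipartiteRisk.PuncturedOrthant d))
    (hμ : BipartiteRisk.IsIntensityMeasure P N V μ)
    -- the random weights and the random bipartite graph, jointly independent of the losses
    (W : Ω → Matrix (Fin q) (Fin d) ℝ≥0) (hW : ∀ i j, Measurable fun ω => W ω i j)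
    (R : Ω → Fin q → Fin d → Prop) (hR : Measurable R)
    (hWpos : ∀ ω i j, R ω i j → 0 < W ω i j)
    (hindep : IndepFun V (fun ω => ((fun i j => W ω i j : Fin q → Fin d → ℝ≥0), R ω)) P)
    -- the moment condition on the weights, for some matrix norm
    (M : Seminorm ℝ (Matrix (Fin q) (Fin d) ℝ)) (hM : BipartiteRisk.IsNorm M)
    (δ : ℝ) (hδ : 0 < δ)
    (hWmoment : ∫⁻ ω, ENNReal.ofReal (M ((W ω).map (fun x => (x : ℝ))) ^ (α + δ)) ∂P < ⊤)
    -- the aggregation functions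
    (g h : (Fin q → ℝ≥0) → ℝ≥0) (hg : Continuous g) (hh : Continuous h)
    (hg_hom : BipartiteRisk.IsOneHomogeneous g) (hh_hom : BipartiteRisk.IsOneHomogeneous h)
    (u : ℝ≥0) (hu : 0 < u)
    (A : Ω → Matrix (Fin q) (Fin d) ℝ≥0) (hA : A = BipartiteRisk.weightedAdjacency W R)
    (F : Ω → Fin q → ℝ≥0) (hF : F = BipartiteRisk.exposure A V) :
    (BipartiteRisk.AsymptoticallyIndependent μ →
      BipartiteRisk.constInd P A K α h ≠ 0 →
      BipartiteRisk.constInd P A K α h ≠ ⊤ ∧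
      Tendsto (fun t : ℝ≥0 => cond P {ω | u * t < h (F ω)} {ω | t < g (F ω)}) atTop
        (𝓝 ((BipartiteRisk.constInd P A K α h)⁻¹ *
          ∑ j, BipartiteRisk.expectMin P A K α u g h (Pi.single j 1)))) ∧
    (BipartiteRisk.AsymptoticallyFullyDependent K α μ →
      BipartiteRisk.constDep P A K α h ≠ 0 →
      BipartiteRisk.constDep P A K α h ≠ ⊤ ∧
      Tendsto (fun t : ℝ≥0 => cond P {ω | u * t < h (F ω)} {ω | t < g (F ω)}) atTop
        (𝓝 ((BipartiteRisk.constDep P A K α h)⁻¹ *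
          BipartiteRisk.expectMin P A K α u g h 1))) := by
  have hT : ∀ j, BipartiteRisk.HasTail P α (fun ω => V ω j) (K j) := fun j =>
    BipartiteRisk.hasTail_of_isEquivalent (hPareto j)
  obtain ⟨B, hB⟩ := BipartiteRisk.exists_bound_sum hα hT
  have hWR : Measurable fun ω => ((fun i j => W ω i j : Fin q → Fin d → ℝ≥0), R ω) :=
    (measurable_pi_lambda _ fun i => measurable_pi_lambda _ fun j => hW i j).prodMk hR
  set A' : Ω → Fin q → Fin d → ℝ≥0 := fun ω i j => A ω i j with hA'
  -- Writing `A` as a fixed measurable function of the pair (weights, graph) transfers measurability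
  -- and independence from `V`.
  have hAeq : A' = (fun p : (Fin q → Fin d → ℝ≥0) × (Fin q → Fin d → Prop) => fun i j =>
      BipartiteRisk.weightedAdjacency (fun p : (Fin q → Fin d → ℝ≥0) × (Fin q → Fin d → Prop) =>
        Matrix.of p.1) (fun p => p.2) p i j) ∘
      fun ω => ((fun i j => W ω i j : Fin q → Fin d → ℝ≥0), R ω) := by
    rw [hA', hA]
    rfl
  have hA'm : Measurable A' := by
    rw [hAeq]
    exact BipartiteRisk.measurable_weightedAdjacency.comp hWR
  have hind : IndepFun A' V P := by
    rw [hAeq]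
    exact (hindep.comp measurable_id BipartiteRisk.measurable_weightedAdjacency).symm
  have hmoment : ∫⁻ ω, (((∑ i, ∑ j, A' ω i j) ^ α : ℝ≥0) : ℝ≥0∞) ∂P ≠ ⊤ := by
    -- Deleting edges only decreases entries, so `A` inherits the moment bound from `W`.
    refine ne_top_of_le_ne_top (hM.moment_ne_top hα hδ hWmoment) (lintegral_mono fun ω => ?_)
    refine ENNReal.coe_le_coe.2 (NNReal.rpow_le_rpow ?_ hα.le)
    refine Finset.sum_le_sum fun i _ => Finset.sum_le_sum fun j _ => ?_
    simp only [hA', hA, BipartiteRisk.weightedAdjacency, Matrix.of_apply]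
    split_ifs
    · exact le_rfl
    · exact zero_le
  subst hF
  refine ⟨fun h_ind hC => ?_, fun h_dep hC => ?_⟩
  · exact (h_ind.hasRayTail hα hV hK hT hN hN_unit hμ).tendsto_cond hα hV hB hA'm hind hmoment
      hg hh hg_hom hh_hom hu (BipartiteRisk.constInd_eq P hα A K hh_hom) hC
  · have h1 := (h_dep.hasRayTail hα hV hK hT hN hN_unit hμ).tendsto_cond hα hV hB hA'm hind hmoment
      hg hh hg_hom hh_hom hu
      (C := BipartiteRisk.constDep P A K α h) (by rw [Fintype.sum_unique]; rfl) hC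
    rw [Fintype.sum_unique] at h1
    exact h1
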